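/- Consider a single-server queue modulated by an environment $Z$, an irreducible continuous-time Markov chain on $\{1,\dots,D\}$ with generator $Q$ and invariant distribution $\pi$. While $Z=d$, customers arrive according to a Poisson process of rate $\lambda_d\ge 0$ and the server has capacity $c_d\ge 0$. A customer who arrives while $Z=d$ has an independent service requirement with distribution $H_d$ on $[0,\infty)$ with mean $h_{d1}$ and finite second moment $h_{d2}$, which does not change afterwards. Each customer may also carry a class, possibly correlated with the service requirement, with a joint law that depends on $d$. The service discipline is any work-conserving discipline that does not depend on the state of the environment. The workload $W$ is the total residual service requirement of the customers present; it jumps up by the service requirement of each arriving customer and decreases at rate $c_{Z}$ as long as it is positive. Let $c_\infty=\sum_d\pi_dc_d>0$ and $\rho_\infty=\sum_d\pi_d\lambda_dh_{d1}/c_\infty>0$. Put $\hat\lambda_d=\lambda_d/\rho_\infty$, and for real $N>1$ let $\lambda^{(N)}_d=\hat\lambda_d(1-1/N)$. Let $(W^{(N)},Z^{(N)})$ be the workload and environment, in steady state, of the queue with arrival rates $\lambda^{(N)}_d$ (all other parameters unchanged), and let $p^{(N)}_{0,d}=\mathbb P(W^{(N)}=0,\,Z^{(N)}=d)$. Then $\mathbb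 E W^{(N)}<\infty$ for every $N>1$; $p^{(N)}_{0,d}\to0$ as $N\to\infty$ for every $d$; the linear system $[Qa]_d=c_d-\hat\lambda_dh_{d1}$, $d=1,\dots,D$, has a solution $a\in\mathbb R^D$; and for every solution $a$ of it $$\lim_{N\to\infty}\frac1N\,\mathbb E W^{(N)}=\frac1{c_\infty}\sum_{d=1}^D\pi_d\Bigl[\tfrac12\hat\lambda_dh_{d2}+a_d\bigl(\hat\lambda_dh_{d1}-c_d\bigr)\Bigr].$$ -/

import Mathlib

open MeasureTheory ProbabilityTheory Filter Topology
open scoped NNReal ENNReal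

namespace ModulatedQueue

universe u v

/-- `Q` is the infinitesimal generator of a continuous-time Markov chain on `Fin D`. -/
structure IsGenerator {D : ℕ} (Q : Matrix (Fin D) (Fin D) ℝ) : Prop where
  off_diag_nonneg : ∀ d l, d ≠ l → 0 ≤ Q d l
  row_sum : ∀ d, ∑ l, Q d l = 0

/-- Every state can be reached from every other one through transitions of positive rate. -/
def IsIrreducible {D : ℕ} (Q : Matrix (Fin D) (Fin D) ℝ) : Prop :=
  ∀ d l, Relation.ReflTransGen (fun i j => i ≠ j ∧ 0 < Q i j) d l

/-- `p` is an invariant probability vector of the generator `Q`. -/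
structure IsInvariant {D : ℕ} (Q : Matrix (Fin D) (Fin D) ℝ) (p : Fin D → ℝ) : Prop where
  nonneg : ∀ d, 0 ≤ p d
  sum_eq_one : ∑ d, p d = 1
  balance : Matrix.vecMul p Q = 0

/-- The parameters of a single-server queue modulated by an environment with states `Fin D`.
A customer is a pair (class, service requirement) in `K × ℝ≥0`; `K` is a one-point type in the
single-class queue. The marginal on `ℝ≥0` of `customerLaw d` is the service requirement
distribution `H_d`. -/
structure Params (D : ℕ) (K : Type v) [MeasurableSpace K] where
  /-- the generator `Q` of the environment -/
  gen : Matrix (Fin D) (Fin D) ℝ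
  /-- the Poisson arrival rate `λ_d` in state `d` -/
  rate : Fin D → ℝ
  /-- the service capacity `c_d` in state `d` -/
  cap : Fin D → ℝ
  /-- the law of (class, service requirement) of a customer who arrives in state `d` -/
  customerLaw : Fin D → Measure (K × ℝ≥0)

namespace Params

variable {D : ℕ} {K : Type v} [MeasurableSpace K] (M : Params D K)

/-- The first moment `h_{d1}` of the service requirement. -/
noncomputable def h1 (d : Fin D) : ℝ := ∫ z, (z.2 : ℝ) ∂(M.customerLaw d)

/-- The second moment `h_{d2}` of the service requirement. -/
noncomputable def h2 (d : Fin D) : ℝ := ∫ z, (z.2 : ℝ) ^ 2 ∂(M.customerLaw d)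

/-- The average capacity `c_∞`; here `p` is the invariant distribution of the environment. -/
def capAvg (p : Fin D → ℝ) : ℝ := ∑ d, p d * M.cap d

/-- The traffic intensity `ρ_∞`. -/
noncomputable def load (p : Fin D → ℝ) : ℝ := (∑ d, p d * M.rate d * M.h1 d) / M.capAvg p

/-- The limiting arrival rate `λ_d / ρ_∞`. -/
noncomputable def rateHat (p : Fin D → ℝ) (d : Fin D) : ℝ := M.rate d / M.load p

/-- The queue with arrival rates `(λ_d / ρ_∞) (1 - 1 / N)`, all else unchanged. -/
noncomputable def scaled (p : Fin D → ℝ) (N : ℝ) : Params D K :=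
  { M with rate := fun d => M.rate d / M.load p * (1 - 1 / N) }

/-- The standing assumptions on the parameters. -/
structure IsAdmissible : Prop where
  generator : IsGenerator M.gen
  irreducible : IsIrreducible M.gen
  rate_nonneg : ∀ d, 0 ≤ M.rate d
  cap_nonneg : ∀ d, 0 ≤ M.cap d
  prob : ∀ d, IsProbabilityMeasure (M.customerLaw d)
  second_moment : ∀ d, Integrable (fun z : K × ℝ≥0 => (z.2 : ℝ) ^ 2) (M.customerLaw d)

end Params

/-- A (work-conserving, possibly randomized) service discipline that does not depend on the
environment. A point of `State` describes the content of the queue together with everything that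
the server keeps track of: order of arrival, classes, attained service, and so on. The environment
enters only through the speed at which capacity is delivered: neither `serve` nor `join` sees it.
Subtraction in `ℝ≥0` is `max (a - b) 0`. -/
structure ServiceDiscipline (K : Type v) [MeasurableSpace K] where
  State : Type u
  [measurableSpace : MeasurableSpace State]
  /-- the residual service requirements of the customers who are present -/
  residual : State → Multiset ℝ≥0
  measurable_residual_sum : Measurable fun x => (residual x).sum
  /-- `serve (b, x)`: law of the state that is reached from `x`, if there are no arrivals, once
  the server has made an amount `b` of capacity available -/
  serve : Kernel (ℝ≥0 × State) State
  serve_markov : IsMarkovKernel serve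
  serve_zero : ∀ x, serve (0, x) = Measure.dirac x
  serve_add : ∀ b b' x, serve (b + b', x) = (serve (b, x)).bind fun y => serve (b', y)
  /-- work conservation: the server works at full capacity as long as there is work -/
  serve_residual : ∀ b x, ∀ᵐ y ∂(serve (b, x)), (residual y).sum = (residual x).sum - b
  /-- `join (x, z)`: law of the state right after customer `z` has joined a queue in state `x` -/
  join : Kernel (State × (K × ℝ≥0)) State
  join_markov : IsMarkovKernel join
  join_residual : ∀ x z, ∀ᵐ y ∂(join (x, z)), residual y = z.2 ::ₘ residual x

attribute [instance] ServiceDiscipline.measurableSpace ServiceDiscipline.serve_markov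
  ServiceDiscipline.join_markov

/-- The workload: the total residual service requirement. -/
def ServiceDiscipline.workload {K : Type v} [MeasurableSpace K] (S : ServiceDiscipline.{u} K)
    (x : S.State) : ℝ≥0 := (S.residual x).sum

section Dynamics

variable {D : ℕ} {K : Type v} [MeasurableSpace K] (M : Params D K) (S : ServiceDiscipline.{u} K)

/-- Total rate of the events (an arrival or a jump of the environment) in state `d`. -/
def eventRate (d : Fin D) : ℝ := M.rate d + ∑ l ∈ Finset.univ.erase d, M.gen d l

/-- `transitionAux n t f (x, d)` is the expectation of `f (X t, Z t)` on the event that exactly `n`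
events (arrivals and jumps of the environment) occur in `[0, t]`, if `(X 0, Z 0) = (x, d)`. While
the environment is in state `d`, capacity is delivered at speed `c_d`, customers arrive at rate
`λ_d`, and the environment jumps to `l ≠ d` at rate `q_{dl}`. The recursion is on the first
event; `s` is its time. -/
noncomputable def transitionAux : ℕ → ℝ → (S.State × Fin D → ℝ≥0∞) → S.State × Fin D → ℝ≥0∞
  | 0, t, f, (x, d) =>
      ENNReal.ofReal (Real.exp (-(eventRate M d * t))) *
        ∫⁻ y, f (y, d) ∂(S.serve ((M.cap d * t).toNNReal, x))
  | n + 1, t, f, (x, d) =>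
      ∫⁻ s in Set.Icc 0 t, ENNReal.ofReal (Real.exp (-(eventRate M d * s))) *
        ∫⁻ y,
          (ENNReal.ofReal (M.rate d) *
              ∫⁻ z, ∫⁻ y', transitionAux n (t - s) f (y', d) ∂(S.join (y, z)) ∂(M.customerLaw d)
            + ∑ l ∈ Finset.univ.erase d,
                ENNReal.ofReal (M.gen d l) * transitionAux n (t - s) f (y, l))
          ∂(S.serve ((M.cap d * s).toNNReal, x))

/-- The transition operator `f ↦ E[f (X t, Z t) | (X 0, Z 0) = ·]` of the Markov process formed by
the queue and its environment. -/
noncomputable def transition (t : ℝ) (f : S.State × Fin D → ℝ≥0∞) (q : S.State × Fin D) : ℝ≥0∞ :=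
  ∑' n, transitionAux M S n t f q

/-- If `(X 0, Z 0)` has law `μ`, the process (workload, environment) is in steady state: its law at
time `t` is the same for all `t ≥ 0`. -/
structure IsSteadyState (μ : Measure (S.State × Fin D)) : Prop where
  prob : IsProbabilityMeasure μ
  stationary : ∀ t : ℝ, 0 ≤ t → ∀ f : ℝ≥0 × Fin D → ℝ≥0∞, Measurable f →
    ∫⁻ q, transition M S t (fun r => f (S.workload r.1, r.2)) q ∂μ
      = ∫⁻ q, f (S.workload q.1, q.2) ∂μ

end Dynamics

end ModulatedQueue

/-!
Work conservation makes (workload, environment) an autonomous Markov process, whose transition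
operator is the Dyson series over the number of arrivals and jumps in `[0, t]`. Applied to the test
functions `β_d e^{-θ w}`, stationarity to first order in `t` gives, for the transforms
`Φ_d(θ) = E[e^{-θ W}; Z = d]`, the balance equations
`(Φ(θ) Q)_k = θ c_k p_{0,k} - ψ_k(θ) Φ_k(θ)`, where `ψ_k(θ) = c_k θ - λ_k (1 - E e^{-θ B_k})`.

Letting `θ → ∞` bounds the flow into `k` of the idle probabilities by `λ_k p_{0,k}`; letting `θ → 0`
gives `∑ c_k p_{0,k} = ∑ π_k (c_k - λ_k h_{k1})`, which is `c_∞ / N` for the `N`-th queue. Hence an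
idle probability with `c_k > 0` tends to `0`, and the flow bound propagates this along the
transitions of the environment.

For the mean, weight the balance equations by a solution `b` of
`(Q b)_d = c_d - λ_d h_{d1} - ε`: the first-order terms cancel and the second-order expansion at
`θ = 0` yields `ε E W`. For the `N`-th queue `ε = c_∞ / N`, and `b = a + a' / N` where
`(Q a')_d = λ̂_d h_{d1} - c_∞`, so only `a` survives in the limit.
-/

namespace ModulatedQueue

section Generator

open scoped Matrix

variable {D : ℕ} {Q : Matrix (Fin D) (Fin D) ℝ} {p : Fin D → ℝ}

theorem IsGenerator.mulVec_one (hQ : IsGenerator Q) : Q *ᵥ 1 = 0 := by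
  ext d
  rw [Matrix.mulVec, dotProduct_one]
  exact hQ.row_sum d

theorem IsGenerator.eq_of_isMax_of_pos (hQ : IsGenerator Q) {a : Fin D → ℝ} {i j : Fin D}
    (ha : (Q *ᵥ a) i = 0) (hmax : ∀ l, a l ≤ a i) (hpos : 0 < Q i j) :
    a j = a i := by
  have hsum : ∑ l, Q i l * (a i - a l) = 0 := by
    have ha' : ∑ l, Q i l * a l = 0 := ha
    simp only [mul_sub, Finset.sum_sub_distrib, ← Finset.sum_mul, hQ.row_sum, ha', zero_mul,
      sub_zero]
  have hnonneg : ∀ l ∈ Finset.univ, 0 ≤ Q i l * (a i - a l) := by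
    intro l _
    obtain rfl | hl := eq_or_ne i l
    · simp
    · exact mul_nonneg (hQ.off_diag_nonneg i l hl) (sub_nonneg.2 (hmax l))
  have hterm := (Finset.sum_eq_zero_iff_of_nonneg hnonneg).1 hsum j (Finset.mem_univ j)
  exact (sub_eq_zero.1 ((mul_eq_zero.1 hterm).resolve_left hpos.ne')).symm

theorem IsGenerator.eq_of_mulVec_eq_zero (hQ : IsGenerator Q) (hirr : IsIrreducible Q)
    {a : Fin D → ℝ} (ha : Q *ᵥ a = 0) (d l : Fin D) : a d = a l := by
  obtain ⟨m, -, hm⟩ := Finset.exists_max_image Finset.univ a ⟨d, Finset.mem_univ d⟩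
  have eq_max : ∀ i, a i = a m := fun i => by
    induction hirr m i with
    | refl => rfl
    | tail _ hij ih =>
      exact (hQ.eq_of_isMax_of_pos (congrFun ha _) (fun l => ih ▸ hm l (Finset.mem_univ l))
        hij.2).trans ih
  rw [eq_max d, eq_max l]

theorem IsGenerator.finrank_ker_mulVecLin_le_one (hQ : IsGenerator Q) (hirr : IsIrreducible Q) :
    Module.finrank ℝ (LinearMap.ker Q.mulVecLin) ≤ 1 := by
  refine finrank_le_one ⟨1, LinearMap.mem_ker.2 hQ.mulVec_one⟩ ?_
  rintro ⟨a, ha⟩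
  obtain hD | ⟨⟨d₀⟩⟩ := isEmpty_or_nonempty (Fin D)
  · exact ⟨0, Subsingleton.elim _ _⟩
  · refine ⟨a d₀, Subtype.ext (funext fun d => ?_)⟩
    simpa using hQ.eq_of_mulVec_eq_zero hirr (LinearMap.mem_ker.1 ha) d₀ d

theorem IsInvariant.dotProduct_mulVec (hp : IsInvariant Q p) (a : Fin D → ℝ) :
    p ⬝ᵥ Q *ᵥ a = 0 := by
  rw [Matrix.dotProduct_mulVec, hp.balance, zero_dotProduct]

/- The range of `Q` lies in the hyperplane `p ⬝ᵥ v = 0`, and its kernel is at most a line. -/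
theorem IsGenerator.exists_mulVec_eq (hQ : IsGenerator Q) (hirr : IsIrreducible Q)
    (hp : IsInvariant Q p) {v : Fin D → ℝ} (hv : p ⬝ᵥ v = 0) : ∃ a, Q *ᵥ a = v := by
  let φ : Module.Dual ℝ (Fin D → ℝ) := dotProductBilin ℝ ℝ p
  have hφ : φ ≠ 0 := fun h => by
    have hone : p ⬝ᵥ 1 = 0 := LinearMap.congr_fun h 1
    exact one_ne_zero (hp.sum_eq_one.symm.trans ((dotProduct_one p).symm.trans hone))
  have hle : LinearMap.range Q.mulVecLin ≤ LinearMap.ker φ := by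
    rintro _ ⟨a, rfl⟩
    exact hp.dotProduct_mulVec a
  have hrank : Module.finrank ℝ (LinearMap.ker φ) ≤
      Module.finrank ℝ (LinearMap.range Q.mulVecLin) := by
    have := Module.Dual.finrank_ker_add_one_of_ne_zero hφ
    have := LinearMap.finrank_range_add_finrank_ker Q.mulVecLin
    have := hQ.finrank_ker_mulVecLin_le_one hirr
    omega
  have hmem : v ∈ LinearMap.ker φ := hv
  rwa [← Submodule.eq_of_le_of_finrank_le hle hrank] at hmem

theorem IsInvariant.eq_of_vecMul_eq_zero (hp : IsInvariant Q p) (hQ : IsGenerator Q)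
    (hirr : IsIrreducible Q) {p' : Fin D → ℝ} (hsum : ∑ d, p' d = 1) (hbal : p' ᵥ* Q = 0) :
    p' = p := by
  funext k
  obtain ⟨a, ha⟩ := hQ.exists_mulVec_eq hirr hp (v := Pi.single k 1 - p k • 1) (by
    rw [dotProduct_sub, dotProduct_single_one, dotProduct_smul, dotProduct_one, hp.sum_eq_one,
      smul_eq_mul, mul_one, sub_self])
  have hzero : p' ⬝ᵥ Q *ᵥ a = 0 := by
    rw [Matrix.dotProduct_mulVec, hbal, zero_dotProduct]
  rw [ha, dotProduct_sub, dotProduct_single_one, dotProduct_smul, dotProduct_one, hsum,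
    smul_eq_mul, mul_one] at hzero
  exact sub_eq_zero.1 hzero

end Generator

section LaplaceTransform

variable {Ω : Type*} [MeasurableSpace Ω] {μ : Measure Ω} [IsFiniteMeasure μ] {X : Ω → ℝ}

theorem integrable_exp_neg_mul (hX : AEMeasurable X μ) (hpos : 0 ≤ᵐ[μ] X) {θ : ℝ} (hθ : 0 ≤ θ) :
    Integrable (fun ω => Real.exp (-θ * X ω)) μ := by
  simpa only [Pi.neg_apply, neg_mul, mul_neg] using integrable_exp_mul_of_le θ 0 hθ hX.neg
    (hpos.mono fun _ => neg_nonpos.2)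

theorem measureReal_univ_sub_mgf_neg (hX : AEMeasurable X μ) (hpos : 0 ≤ᵐ[μ] X) {θ : ℝ}
    (hθ : 0 ≤ θ) : μ.real Set.univ - mgf X μ (-θ) = ∫ ω, (1 - Real.exp (-θ * X ω)) ∂μ := by
  rw [integral_sub (integrable_const 1) (integrable_exp_neg_mul hX hpos hθ), integral_const,
    smul_eq_mul, mul_one, mgf]

theorem exp_neg_mul_le_one {θ x : ℝ} (hθ : 0 ≤ θ) (hx : 0 ≤ x) : Real.exp (-θ * x) ≤ 1 :=
  Real.exp_le_one_iff.2 (mul_nonpos_of_nonpos_of_nonneg (neg_nonpos.2 hθ) hx)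

theorem tendsto_mgf_neg_nhdsGT_zero (hX : AEMeasurable X μ) (hpos : 0 ≤ᵐ[μ] X) :
    Tendsto (fun θ => mgf X μ (-θ)) (𝓝[>] 0) (𝓝 (μ.real Set.univ)) := by
  rw [← mgf_zero' (X := X)]
  refine tendsto_integral_filter_of_dominated_convergence (fun _ => 1)
    (.of_forall fun θ => aemeasurable_exp_mul _ hX) ?_ (integrable_const _)
    (.of_forall fun ω => ?_)
  · filter_upwards [self_mem_nhdsWithin] with θ hθ
    filter_upwards [hpos] with ω hω
    exact (Real.norm_of_nonneg (Real.exp_pos _).le).trans_le (exp_neg_mul_le_one (le_of_lt hθ) hω)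
  · have hcont : Continuous fun θ : ℝ => Real.exp (-θ * X ω) := by fun_prop
    simpa only [neg_zero] using (hcont.tendsto 0).mono_left nhdsWithin_le_nhds

theorem tendsto_mgf_neg_atTop (hX : Measurable X) (hpos : 0 ≤ᵐ[μ] X) :
    Tendsto (fun θ => mgf X μ (-θ)) atTop (𝓝 (μ.real {ω | X ω = 0})) := by
  have hmeas : MeasurableSet {ω | X ω = 0} := hX (measurableSet_singleton 0)
  rw [← integral_indicator_one hmeas]
  refine tendsto_integral_filter_of_dominated_convergence (fun _ => 1)
    (.of_forall fun θ => aemeasurable_exp_mul _ hX.aemeasurable) ?_ (integrable_const _) ?_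
  · filter_upwards [eventually_ge_atTop 0] with θ hθ
    filter_upwards [hpos] with ω hω
    exact (Real.norm_of_nonneg (Real.exp_pos _).le).trans_le (exp_neg_mul_le_one hθ hω)
  · filter_upwards [hpos] with ω hω
    obtain hzero | hne := eq_or_ne (X ω) 0
    · simp [hzero]
    · rw [Set.indicator_of_notMem (by exact hne)]
      exact Real.tendsto_exp_atBot.comp
        (tendsto_neg_atTop_atBot.atBot_mul_const (lt_of_le_of_ne hω hne.symm))

theorem tendsto_one_sub_exp_neg_mul_div (x : ℝ) :
    Tendsto (fun θ : ℝ => (1 - Real.exp (-θ * x)) / θ) (𝓝[>] 0) (𝓝 x) := by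
  have hderiv : HasDerivAt (fun θ : ℝ => -Real.exp (-θ * x)) x 0 := by
    convert! (((hasDerivAt_id (0 : ℝ)).neg.mul_const x).exp).neg using 1
    simp
  refine hderiv.tendsto_slope_zero_right.congr fun θ => ?_
  simp only [zero_add, neg_zero, zero_mul, Real.exp_zero, smul_eq_mul]
  ring

theorem tendsto_measureReal_univ_sub_mgf_neg_div (hX : Integrable X μ) (hpos : 0 ≤ᵐ[μ] X) :
    Tendsto (fun θ => (μ.real Set.univ - mgf X μ (-θ)) / θ) (𝓝[>] 0) (𝓝 (∫ ω, X ω ∂μ)) := by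
  have hlim : Tendsto (fun θ => ∫ ω, (1 - Real.exp (-θ * X ω)) / θ ∂μ) (𝓝[>] 0)
      (𝓝 (∫ ω, X ω ∂μ)) := by
    refine tendsto_integral_filter_of_dominated_convergence X
      (.of_forall fun θ => by have := hX.aemeasurable; fun_prop) ?_ hX
      (.of_forall fun ω => tendsto_one_sub_exp_neg_mul_div (X ω))
    filter_upwards [self_mem_nhdsWithin] with θ hθ
    filter_upwards [hpos] with ω hω
    have hexp := Real.one_sub_le_exp_neg (θ * X ω)
    rw [Real.norm_of_nonneg (div_nonneg (sub_nonneg.2 (exp_neg_mul_le_one (le_of_lt hθ) hω))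
      (le_of_lt hθ)), div_le_iff₀ hθ, neg_mul]
    linarith
  refine hlim.congr' ?_
  filter_upwards [self_mem_nhdsWithin] with θ hθ
  rw [integral_div, measureReal_univ_sub_mgf_neg hX.aemeasurable hpos (le_of_lt hθ)]

theorem integrable_of_tendsto_measureReal_univ_sub_mgf_neg_div (hX : AEMeasurable X μ)
    (hpos : 0 ≤ᵐ[μ] X) {L : ℝ}
    (hL : Tendsto (fun θ => (μ.real Set.univ - mgf X μ (-θ)) / θ) (𝓝[>] 0) (𝓝 L)) :
    Integrable X μ := by
  obtain ⟨θ, -, hθpos, hθlim⟩ := exists_seq_strictAnti_tendsto (0 : ℝ)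
  have hθ : Tendsto θ atTop (𝓝[>] 0) :=
    tendsto_nhdsWithin_iff.2 ⟨hθlim, .of_forall hθpos⟩
  have hquot_nonneg : ∀ n, 0 ≤ᵐ[μ] fun ω => (1 - Real.exp (-θ n * X ω)) / θ n := fun n => by
    filter_upwards [hpos] with ω hω
    exact div_nonneg (sub_nonneg.2 (exp_neg_mul_le_one (hθpos n).le hω)) (hθpos n).le
  have hquot_int : ∀ n, Integrable (fun ω => (1 - Real.exp (-θ n * X ω)) / θ n) μ := fun n =>
    ((integrable_const 1).sub (integrable_exp_neg_mul hX hpos (hθpos n).le)).div_const _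
  have hlintegral : ∀ n, ∫⁻ ω, ENNReal.ofReal ((1 - Real.exp (-θ n * X ω)) / θ n) ∂μ =
      ENNReal.ofReal ((μ.real Set.univ - mgf X μ (-θ n)) / θ n) := fun n => by
    rw [← ofReal_integral_eq_lintegral_ofReal (hquot_int n) (hquot_nonneg n), integral_div,
      measureReal_univ_sub_mgf_neg hX hpos (hθpos n).le]
  have hliminf : ∫⁻ ω, ENNReal.ofReal (X ω) ∂μ ≤ ENNReal.ofReal L := by
    calc ∫⁻ ω, ENNReal.ofReal (X ω) ∂μ
        = ∫⁻ ω, liminf (fun n => ENNReal.ofReal ((1 - Real.exp (-θ n * X ω)) / θ n)) atTop ∂μ :=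
          lintegral_congr fun ω => (((ENNReal.continuous_ofReal.tendsto _).comp
            ((tendsto_one_sub_exp_neg_mul_div (X ω)).comp hθ)).liminf_eq).symm
      _ ≤ liminf (fun n => ∫⁻ ω, ENNReal.ofReal ((1 - Real.exp (-θ n * X ω)) / θ n) ∂μ) atTop :=
          lintegral_liminf_le' fun n => by fun_prop
      _ = ENNReal.ofReal L := by
          simp only [hlintegral]
          exact ((ENNReal.continuous_ofReal.tendsto _).comp (hL.comp hθ)).liminf_eq
  exact ⟨hX.aestronglyMeasurable, (hasFiniteIntegral_iff_ofReal hpos).2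
    (hliminf.trans_lt ENNReal.ofReal_lt_top)⟩

theorem exp_neg_le_quadratic {x : ℝ} (hx : 0 ≤ x) : Real.exp (-x) ≤ 1 - x + x ^ 2 / 2 := by
  have hexp := Real.quadratic_le_exp_of_nonneg hx
  rw [Real.exp_neg, inv_le_iff_one_le_mul₀ (Real.exp_pos x)]
  nlinarith [mul_le_mul_of_nonneg_left hexp (by nlinarith [sq_nonneg (x - 1)] :
    0 ≤ 1 - x + x ^ 2 / 2), sq_nonneg (x ^ 2)]

theorem tendsto_exp_neg_mul_sub_affine_div_sq (x : ℝ) :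
    Tendsto (fun θ : ℝ => (Real.exp (-θ * x) - 1 + θ * x) / θ ^ 2) (𝓝[>] 0) (𝓝 (x ^ 2 / 2)) := by
  have hcont : Continuous fun θ : ℝ => -θ * x := by fun_prop
  have htaylor : (fun θ : ℝ => Real.exp (-θ * x) - 1 + θ * x - x ^ 2 / 2 * θ ^ 2) =o[𝓝 0]
      fun θ : ℝ => θ ^ 2 := by
    refine (((Real.exp_sub_sum_range_succ_isLittleO_pow 2).comp_tendsto
      (by simpa using hcont.tendsto 0)).congr (fun θ => ?_) (fun θ => ?_)).trans_isBigO
      (Asymptotics.isBigO_const_mul_self (x ^ 2) _ _)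
    · simp [Finset.sum_range_succ]
      ring
    · simp only [Function.comp_apply]
      ring
  have hlim := htaylor.tendsto_div_nhds_zero.mono_left (nhdsWithin_le_nhds (s := Set.Ioi 0))
  refine ((hlim.add_const (x ^ 2 / 2)).congr' ?_).trans (by rw [zero_add])
  filter_upwards [self_mem_nhdsWithin] with θ hθ
  have : θ ≠ 0 := ne_of_gt hθ
  field_simp
  ring

theorem tendsto_mgf_neg_sub_affine_div_sq (hX : AEMeasurable X μ) (hpos : 0 ≤ᵐ[μ] X)
    (hsq : Integrable (fun ω => X ω ^ 2) μ) :
    Tendsto (fun θ => (mgf X μ (-θ) - μ.real Set.univ + θ * ∫ ω, X ω ∂μ) / θ ^ 2) (𝓝[>] 0)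
      (𝓝 ((∫ ω, X ω ^ 2 ∂μ) / 2)) := by
  have hint : Integrable X μ :=
    ((memLp_two_iff_integrable_sq hX.aestronglyMeasurable).2 hsq).integrable one_le_two
  have hlim : Tendsto (fun θ => ∫ ω, (Real.exp (-θ * X ω) - 1 + θ * X ω) / θ ^ 2 ∂μ) (𝓝[>] 0)
      (𝓝 (∫ ω, X ω ^ 2 / 2 ∂μ)) := by
    refine tendsto_integral_filter_of_dominated_convergence (fun ω => X ω ^ 2 / 2)
      (.of_forall fun θ => by fun_prop) ?_ (hsq.div_const 2)
      (.of_forall fun ω => tendsto_exp_neg_mul_sub_affine_div_sq (X ω))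
    filter_upwards [self_mem_nhdsWithin] with θ hθ
    filter_upwards [hpos] with ω hω
    have hlower := Real.one_sub_le_exp_neg (θ * X ω)
    have hupper := exp_neg_le_quadratic (mul_nonneg (le_of_lt hθ) hω)
    rw [neg_mul, Real.norm_of_nonneg (div_nonneg (by linarith) (sq_nonneg θ)),
      div_le_iff₀ (pow_pos hθ 2)]
    linarith
  rw [← integral_div]
  refine hlim.congr' ?_
  filter_upwards [self_mem_nhdsWithin] with θ hθ
  have hexp : Integrable (fun ω => 1 - Real.exp (-θ * X ω)) μ :=
    (integrable_const 1).sub (integrable_exp_neg_mul hX hpos (le_of_lt hθ))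
  rw [← neg_sub (μ.real Set.univ), measureReal_univ_sub_mgf_neg hX hpos (le_of_lt hθ),
    ← integral_const_mul, neg_add_eq_sub, ← integral_sub (hint.const_mul θ) hexp, integral_div]
  congr 2 with ω
  ring

end LaplaceTransform

section Workload

variable {D : ℕ} {K : Type*} [MeasurableSpace K] (S : ServiceDiscipline K)

theorem ServiceDiscipline.measurable_workload : Measurable S.workload :=
  S.measurable_residual_sum

theorem ServiceDiscipline.lintegral_serve_comp_workload (F : ℝ≥0 → ℝ≥0∞) (b : ℝ≥0) (x : S.State) :
    ∫⁻ y, F (S.workload y) ∂(S.serve (b, x)) = F (S.workload x - b) :=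
  lintegral_eq_const ((S.serve_residual b x).mono fun _ hy => congrArg F hy)

theorem ServiceDiscipline.lintegral_join_comp_workload (F : ℝ≥0 → ℝ≥0∞) (x : S.State)
    (z : K × ℝ≥0) : ∫⁻ y, F (S.workload y) ∂(S.join (x, z)) = F (z.2 + S.workload x) :=
  lintegral_eq_const ((S.join_residual x z).mono fun y hy => by
    rw [workload, hy, Multiset.sum_cons, workload])

variable (M : Params D K)

/-- The expectation of `G` at time `t` of the pair (workload, environment), on the event that
nothing happens up to time `t`. -/
noncomputable def quietOp (t : ℝ) (G : ℝ≥0 × Fin D → ℝ≥0∞) (r : ℝ≥0 × Fin D) : ℝ≥0∞ :=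
  ENNReal.ofReal (Real.exp (-(eventRate M r.2 * t))) * G (r.1 - (M.cap r.2 * t).toNNReal, r.2)

/-- The rate at which arrivals and jumps of the environment produce `G`: the part of the generator
of the pair (workload, environment) that increases the value of a function. -/
noncomputable def eventOp (G : ℝ≥0 × Fin D → ℝ≥0∞) (r : ℝ≥0 × Fin D) : ℝ≥0∞ :=
  ENNReal.ofReal (M.rate r.2) * ∫⁻ z, G (z.2 + r.1, r.2) ∂(M.customerLaw r.2) +
    ∑ l ∈ Finset.univ.erase r.2, ENNReal.ofReal (M.gen r.2 l) * G (r.1, l)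

/-- The term of order `n` of the Dyson series of the pair (workload, environment): the expectation
of `G` at time `t` on the event that exactly `n` arrivals and jumps occur up to time `t`. -/
noncomputable def dyson : ℕ → ℝ → (ℝ≥0 × Fin D → ℝ≥0∞) → ℝ≥0 × Fin D → ℝ≥0∞
  | 0, t, G, r => quietOp M t G r
  | n + 1, t, G, r => ∫⁻ s in Set.Icc 0 t, quietOp M s (eventOp M (dyson n (t - s) G)) r

/- Work conservation makes the workload evolve autonomously, whatever the discipline. -/
theorem transitionAux_comp_workload (G : ℝ≥0 × Fin D → ℝ≥0∞) (n : ℕ) (t : ℝ)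
    (q : S.State × Fin D) :
    transitionAux M S n t (fun r => G (S.workload r.1, r.2)) q =
      dyson M n t G (S.workload q.1, q.2) := by
  induction n generalizing t q with
  | zero =>
    obtain ⟨x, d⟩ := q
    rw [transitionAux, S.lintegral_serve_comp_workload (fun w => G (w, d)), dyson, quietOp]
  | succ n ih =>
    obtain ⟨x, d⟩ := q
    simp only [transitionAux, ih, dyson, quietOp]
    refine lintegral_congr fun s => congrArg _ ?_
    simp only [S.lintegral_join_comp_workload (fun w => dyson M n (t - s) G (w, d))]
    exact S.lintegral_serve_comp_workload
      (fun w => eventOp M (dyson M n (t - s) G) (w, d)) _ x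

theorem transition_comp_workload (G : ℝ≥0 × Fin D → ℝ≥0∞) (t : ℝ) (q : S.State × Fin D) :
    transition M S t (fun r => G (S.workload r.1, r.2)) q =
      ∑' n, dyson M n t G (S.workload q.1, q.2) :=
  tsum_congr fun n => transitionAux_comp_workload S M G n t q

end Workload

section DysonSeries

variable {D : ℕ} {K : Type*} [MeasurableSpace K] {M : Params D K}

theorem Params.IsAdmissible.gen_nonneg_of_mem_erase (hM : M.IsAdmissible) {d l : Fin D}
    (hl : l ∈ Finset.univ.erase d) : 0 ≤ M.gen d l :=
  hM.generator.off_diag_nonneg d l (Finset.ne_of_mem_erase hl).symm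

theorem Params.IsAdmissible.eventRate_nonneg (hM : M.IsAdmissible) (d : Fin D) :
    0 ≤ eventRate M d :=
  add_nonneg (hM.rate_nonneg d) (Finset.sum_nonneg fun _ => hM.gen_nonneg_of_mem_erase)

theorem Params.IsAdmissible.eventRate_eq (hM : M.IsAdmissible) (d : Fin D) :
    eventRate M d = M.rate d - M.gen d d := by
  rw [eventRate, Finset.sum_erase_eq_sub (Finset.mem_univ d), hM.generator.row_sum, zero_sub,
    sub_eq_add_neg]

variable (M) in
theorem quietOp_mono (t : ℝ) {G G' : ℝ≥0 × Fin D → ℝ≥0∞} (h : ∀ r, G r ≤ G' r)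
    (r : ℝ≥0 × Fin D) : quietOp M t G r ≤ quietOp M t G' r :=
  mul_le_mul_right (h _) _

variable (M) in
theorem quietOp_const_mul (t : ℝ) (c : ℝ≥0∞) (G : ℝ≥0 × Fin D → ℝ≥0∞) (r : ℝ≥0 × Fin D) :
    quietOp M t (fun r => c * G r) r = c * quietOp M t G r :=
  mul_left_comm _ _ _

variable (M) in
theorem eventOp_mono {G G' : ℝ≥0 × Fin D → ℝ≥0∞} (h : ∀ r, G r ≤ G' r) (r : ℝ≥0 × Fin D) :
    eventOp M G r ≤ eventOp M G' r := by
  unfold eventOp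
  gcongr <;> exact h _

variable (M) in
theorem eventOp_const_mul {c : ℝ≥0∞} (hc : c ≠ ∞) (G : ℝ≥0 × Fin D → ℝ≥0∞) (r : ℝ≥0 × Fin D) :
    eventOp M (fun r => c * G r) r = c * eventOp M G r := by
  simp only [eventOp, lintegral_const_mul' c _ hc, mul_add, Finset.mul_sum, mul_left_comm c]

theorem Params.IsAdmissible.eventOp_const (hM : M.IsAdmissible) (c : ℝ≥0∞) (r : ℝ≥0 × Fin D) :
    eventOp M (fun _ => c) r = ENNReal.ofReal (eventRate M r.2) * c := by
  have := hM.prob r.2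
  rw [eventOp, lintegral_const, measure_univ, mul_one, ← Finset.sum_mul, ← add_mul, eventRate,
    ENNReal.ofReal_add (hM.rate_nonneg _)
      (Finset.sum_nonneg fun _ => hM.gen_nonneg_of_mem_erase),
    ENNReal.ofReal_sum_of_nonneg fun _ => hM.gen_nonneg_of_mem_erase]

theorem Params.IsAdmissible.quietOp_le (hM : M.IsAdmissible) {t : ℝ} (ht : 0 ≤ t)
    {G : ℝ≥0 × Fin D → ℝ≥0∞} {B : ℝ≥0∞} (hG : ∀ r, G r ≤ B) (r : ℝ≥0 × Fin D) :
    quietOp M t G r ≤ B := by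
  refine (mul_le_of_le_one_left' (ENNReal.ofReal_le_one.2 (Real.exp_le_one_iff.2 ?_))).trans (hG _)
  exact neg_nonpos.2 (mul_nonneg (hM.eventRate_nonneg _) ht)

theorem Params.IsAdmissible.dyson_le (hM : M.IsAdmissible) {R : ℝ} (hR : ∀ d, eventRate M d ≤ R)
    {G : ℝ≥0 × Fin D → ℝ≥0∞} {B : ℝ≥0∞} (hG : ∀ r, G r ≤ B) (n : ℕ) {t : ℝ} (ht : 0 ≤ t)
    (r : ℝ≥0 × Fin D) : dyson M n t G r ≤ ENNReal.ofReal ((R * t) ^ n) * B := by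
  induction n generalizing t r with
  | zero => simpa [dyson] using hM.quietOp_le ht hG r
  | succ n ih =>
    have hR0 : 0 ≤ R := (hM.eventRate_nonneg r.2).trans (hR r.2)
    have hevent : ∀ s ∈ Set.Icc 0 t, ∀ r', eventOp M (dyson M n (t - s) G) r' ≤
        ENNReal.ofReal R * (ENNReal.ofReal ((R * t) ^ n) * B) := fun s hs r' => by
      calc eventOp M (dyson M n (t - s) G) r'
          ≤ eventOp M (fun _ => ENNReal.ofReal ((R * t) ^ n) * B) r' := by
            refine eventOp_mono M (fun r'' => (ih (sub_nonneg.2 hs.2) r'').trans ?_) r'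
            have := sub_nonneg.2 hs.2
            gcongr
            exact sub_le_self t hs.1
        _ ≤ ENNReal.ofReal R * (ENNReal.ofReal ((R * t) ^ n) * B) := by
            rw [hM.eventOp_const]
            gcongr
            exact hR _
    calc dyson M (n + 1) t G r
        ≤ ∫⁻ _ in Set.Icc 0 t, ENNReal.ofReal R * (ENNReal.ofReal ((R * t) ^ n) * B) :=
          setLIntegral_mono' measurableSet_Icc fun s hs => hM.quietOp_le hs.1 (hevent s hs) r
      _ = ENNReal.ofReal ((R * t) ^ (n + 1)) * B := by
          rw [setLIntegral_const, Real.volume_Icc, sub_zero, ← mul_assoc, mul_right_comm,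
            ← ENNReal.ofReal_mul hR0, ← ENNReal.ofReal_mul (by positivity)]
          ring_nf

theorem Params.IsAdmissible.tsum_dyson_add_two_le (hM : M.IsAdmissible) {R : ℝ}
    (hR : ∀ d, eventRate M d ≤ R) {G : ℝ≥0 × Fin D → ℝ≥0∞} {B : ℝ≥0∞} (hG : ∀ r, G r ≤ B) {t : ℝ}
    (ht : 0 ≤ t) (hRt : R * t ≤ 1 / 2) (r : ℝ≥0 × Fin D) :
    ∑' n, dyson M (n + 2) t G r ≤ ENNReal.ofReal (2 * (R * t) ^ 2) * B := by
  have hRt0 : 0 ≤ R * t := mul_nonneg ((hM.eventRate_nonneg r.2).trans (hR r.2)) ht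
  calc ∑' n, dyson M (n + 2) t G r
      ≤ ∑' n : ℕ, ENNReal.ofReal ((R * t) ^ 2 * (1 / 2) ^ n) * B := by
        refine ENNReal.tsum_le_tsum fun n => (hM.dyson_le hR hG _ ht r).trans ?_
        rw [pow_add, mul_comm ((R * t) ^ n)]
        gcongr
    _ = ENNReal.ofReal (2 * (R * t) ^ 2) * B := by
        rw [ENNReal.tsum_mul_right, ← ENNReal.ofReal_tsum_of_nonneg (fun n => by positivity)
          (summable_geometric_two.mul_left _), tsum_mul_left, tsum_geometric_two, mul_comm 2]

theorem tsum_eq_add_add_tsum_add_two (u : ℕ → ℝ≥0∞) :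
    ∑' n, u n = u 0 + u 1 + ∑' n, u (n + 2) := by
  rw [← Summable.sum_add_tsum_nat_add' (f := u) (k := 2) ENNReal.summable,
    Finset.sum_range_succ, Finset.sum_range_one]

theorem le_tsum_dyson (t : ℝ) (G : ℝ≥0 × Fin D → ℝ≥0∞) (r : ℝ≥0 × Fin D) :
    dyson M 0 t G r + dyson M 1 t G r ≤ ∑' n, dyson M n t G r :=
  le_self_add.trans (tsum_eq_add_add_tsum_add_two fun n => dyson M n t G r).ge

theorem Params.IsAdmissible.tsum_dyson_le (hM : M.IsAdmissible) {R : ℝ}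
    (hR : ∀ d, eventRate M d ≤ R) {G : ℝ≥0 × Fin D → ℝ≥0∞} {B : ℝ≥0∞} (hG : ∀ r, G r ≤ B) {t : ℝ}
    (ht : 0 ≤ t) (hRt : R * t ≤ 1 / 2) (r : ℝ≥0 × Fin D) :
    ∑' n, dyson M n t G r ≤
      dyson M 0 t G r + dyson M 1 t G r + ENNReal.ofReal (2 * (R * t) ^ 2) * B := by
  rw [tsum_eq_add_add_tsum_add_two]
  gcongr
  exact hM.tsum_dyson_add_two_le hR hG ht hRt r

end DysonSeries

section ExponentialTestFunctions

variable {D : ℕ} {K : Type*} [MeasurableSpace K] {M : Params D K} {θ : ℝ} {β : Fin D → ℝ}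

/-- The function `(w, d) ↦ β_d e^{-θ w}` of workload and environment. -/
noncomputable def expTest (θ : ℝ) (β : Fin D → ℝ) (r : ℝ≥0 × Fin D) : ℝ :=
  β r.2 * Real.exp (-θ * r.1)

/-- The Laplace transform, at `θ`, of the service requirement of a customer who arrives in state
`d`. -/
noncomputable def Params.serviceLaplace (M : Params D K) (θ : ℝ) (d : Fin D) : ℝ :=
  mgf (fun z => (z.2 : ℝ)) (M.customerLaw d) (-θ)

/-- The weights of `eventOp M (expTest θ β)`, which is again an exponential test function. -/
noncomputable def Params.eventGain (M : Params D K) (θ : ℝ) (β : Fin D → ℝ) (d : Fin D) : ℝ :=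
  M.rate d * M.serviceLaplace θ d * β d + ∑ l ∈ Finset.univ.erase d, M.gen d l * β l

/-- The real-valued form of `quietOp M t (expTest θ β)`. -/
noncomputable def quietTest (M : Params D K) (θ : ℝ) (β : Fin D → ℝ) (t : ℝ) (r : ℝ≥0 × Fin D) :
    ℝ :=
  Real.exp (-(eventRate M r.2 * t)) * expTest θ β (r.1 - (M.cap r.2 * t).toNNReal, r.2)

theorem expTest_nonneg (hβ : 0 ≤ β) (r : ℝ≥0 × Fin D) : 0 ≤ expTest θ β r :=
  mul_nonneg (hβ _) (Real.exp_pos _).le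

theorem expTest_le_sum (hθ : 0 ≤ θ) (hβ : 0 ≤ β) (r : ℝ≥0 × Fin D) :
    expTest θ β r ≤ ∑ d, β d :=
  (mul_le_of_le_one_right (hβ _) (exp_neg_mul_le_one hθ r.1.2)).trans
    (Finset.single_le_sum (fun d _ => hβ d) (Finset.mem_univ r.2))

variable (θ β) in
theorem measurable_expTest : Measurable (expTest θ β) :=
  ((measurable_of_finite β).comp measurable_snd).mul (by fun_prop)

variable (θ β) in
theorem expTest_add (z w : ℝ≥0) (d : Fin D) :
    expTest θ β (z + w, d) = Real.exp (-θ * z) * expTest θ β (w, d) := by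
  simp only [expTest, NNReal.coe_add, mul_add, Real.exp_add]
  ring

theorem expTest_le_expTest_sub (hθ : 0 ≤ θ) (hβ : 0 ≤ β) (w b : ℝ≥0) (d : Fin D) :
    expTest θ β (w, d) ≤ expTest θ β (w - b, d) := by
  refine mul_le_mul_of_nonneg_left (Real.exp_le_exp.2 ?_) (hβ d)
  exact mul_le_mul_of_nonpos_left (NNReal.coe_le_coe.2 tsub_le_self) (neg_nonpos.2 hθ)

theorem expTest_sub_le (hθ : 0 ≤ θ) (hβ : 0 ≤ β) (w b : ℝ≥0) (d : Fin D) :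
    expTest θ β (w - b, d) ≤ Real.exp (θ * b) * expTest θ β (w, d) := by
  rw [expTest, expTest, mul_left_comm, ← Real.exp_add]
  refine mul_le_mul_of_nonneg_left (Real.exp_le_exp.2 ?_) (hβ d)
  have hle : (w : ℝ) ≤ (w - b : ℝ≥0) + b := by exact_mod_cast le_tsub_add
  linarith [mul_le_mul_of_nonneg_left hle hθ]

theorem Params.IsAdmissible.eventGain_nonneg (hM : M.IsAdmissible) (θ : ℝ) (hβ : 0 ≤ β) :
    0 ≤ M.eventGain θ β := fun d =>
  add_nonneg (mul_nonneg (mul_nonneg (hM.rate_nonneg d) mgf_nonneg) (hβ d))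
    (Finset.sum_nonneg fun l hl => mul_nonneg (hM.gen_nonneg_of_mem_erase hl) (hβ l))

theorem Params.IsAdmissible.lintegral_expTest_add (hM : M.IsAdmissible) (hθ : 0 ≤ θ) (hβ : 0 ≤ β)
    (w : ℝ≥0) (d : Fin D) :
    ∫⁻ z, ENNReal.ofReal (expTest θ β (z.2 + w, d)) ∂(M.customerLaw d) =
      ENNReal.ofReal (M.serviceLaplace θ d * expTest θ β (w, d)) := by
  have := hM.prob d
  have hint : Integrable (fun z => Real.exp (-θ * z.2)) (M.customerLaw d) :=
    integrable_exp_neg_mul (by fun_prop) (.of_forall fun z => z.2.2) hθ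
  simp only [expTest_add]
  rw [← ofReal_integral_eq_lintegral_ofReal (hint.mul_const _)
    (.of_forall fun z => mul_nonneg (Real.exp_pos _).le (expTest_nonneg hβ _)),
    integral_mul_const, serviceLaplace, mgf]

theorem Params.IsAdmissible.eventOp_expTest (hM : M.IsAdmissible) (hθ : 0 ≤ θ) (hβ : 0 ≤ β)
    (r : ℝ≥0 × Fin D) :
    eventOp M (fun r => ENNReal.ofReal (expTest θ β r)) r =
      ENNReal.ofReal (expTest θ (M.eventGain θ β) r) := by
  have hjump : ∀ l ∈ Finset.univ.erase r.2, 0 ≤ M.gen r.2 l * expTest θ β (r.1, l) := fun l hl =>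
    mul_nonneg (hM.gen_nonneg_of_mem_erase hl) (expTest_nonneg hβ _)
  have harrival : 0 ≤ M.rate r.2 * (M.serviceLaplace θ r.2 * expTest θ β r) :=
    mul_nonneg (hM.rate_nonneg _) (mul_nonneg mgf_nonneg (expTest_nonneg hβ _))
  have hsplit : expTest θ (M.eventGain θ β) r =
      M.rate r.2 * (M.serviceLaplace θ r.2 * expTest θ β r) +
        ∑ l ∈ Finset.univ.erase r.2, M.gen r.2 l * expTest θ β (r.1, l) := by
    simp only [expTest, eventGain, add_mul, Finset.sum_mul, mul_assoc]
  rw [hsplit, ENNReal.ofReal_add harrival (Finset.sum_nonneg hjump),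
    ENNReal.ofReal_sum_of_nonneg hjump, ENNReal.ofReal_mul (hM.rate_nonneg _), eventOp,
    hM.lintegral_expTest_add hθ hβ]
  congr 1
  exact Finset.sum_congr rfl fun l hl => (ENNReal.ofReal_mul (hM.gen_nonneg_of_mem_erase hl)).symm

variable {R t : ℝ}

theorem quietOp_expTest (t : ℝ) (r : ℝ≥0 × Fin D) :
    quietOp M t (fun r => ENNReal.ofReal (expTest θ β r)) r =
      ENNReal.ofReal (quietTest M θ β t r) :=
  (ENNReal.ofReal_mul (Real.exp_pos _).le).symm

theorem quietTest_nonneg (hβ : 0 ≤ β) (t : ℝ) (r : ℝ≥0 × Fin D) : 0 ≤ quietTest M θ β t r :=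
  mul_nonneg (Real.exp_pos _).le (expTest_nonneg hβ _)

theorem Params.IsAdmissible.quietTest_le (hM : M.IsAdmissible) (hθ : 0 ≤ θ) (hβ : 0 ≤ β)
    (hR : ∀ d, eventRate M d + θ * M.cap d ≤ R) (ht : 0 ≤ t) (r : ℝ≥0 × Fin D) :
    quietTest M θ β t r ≤ Real.exp (R * t) * expTest θ β r := by
  have hb := Real.coe_toNNReal _ (mul_nonneg (hM.cap_nonneg r.2) ht)
  calc quietTest M θ β t r
      ≤ 1 * (Real.exp (θ * (M.cap r.2 * t)) * expTest θ β r) := by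
        refine mul_le_mul (Real.exp_le_one_iff.2 ?_) ?_ (expTest_nonneg hβ _) zero_le_one
        · exact neg_nonpos.2 (mul_nonneg (hM.eventRate_nonneg _) ht)
        · simpa only [hb] using expTest_sub_le hθ hβ r.1 (M.cap r.2 * t).toNNReal r.2
    _ ≤ Real.exp (R * t) * expTest θ β r := by
        have hcap : θ * M.cap r.2 ≤ R := by linarith [hR r.2, hM.eventRate_nonneg r.2]
        have := expTest_nonneg (θ := θ) hβ r
        rw [one_mul, ← mul_assoc]
        gcongr

theorem Params.IsAdmissible.le_quietTest (hM : M.IsAdmissible) (hθ : 0 ≤ θ) (hβ : 0 ≤ β)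
    (hR : ∀ d, eventRate M d + θ * M.cap d ≤ R) (ht : 0 ≤ t) (r : ℝ≥0 × Fin D) :
    Real.exp (-(R * t)) * expTest θ β r ≤ quietTest M θ β t r := by
  have hrate : eventRate M r.2 ≤ R := by linarith [hR r.2, mul_nonneg hθ (hM.cap_nonneg r.2)]
  have := expTest_nonneg (θ := θ) hβ r
  rw [quietTest]
  gcongr
  exact expTest_le_expTest_sub hθ hβ _ _ _

theorem Params.IsAdmissible.quietOp_expTest_le (hM : M.IsAdmissible) (hθ : 0 ≤ θ) (hβ : 0 ≤ β)
    (hR : ∀ d, eventRate M d + θ * M.cap d ≤ R) (ht : 0 ≤ t) (r : ℝ≥0 × Fin D) :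
    quietOp M t (fun r => ENNReal.ofReal (expTest θ β r)) r ≤
      ENNReal.ofReal (Real.exp (R * t)) * ENNReal.ofReal (expTest θ β r) := by
  rw [quietOp_expTest, ← ENNReal.ofReal_mul (Real.exp_pos _).le]
  exact ENNReal.ofReal_le_ofReal (hM.quietTest_le hθ hβ hR ht r)

theorem Params.IsAdmissible.le_quietOp_expTest (hM : M.IsAdmissible) (hθ : 0 ≤ θ) (hβ : 0 ≤ β)
    (hR : ∀ d, eventRate M d + θ * M.cap d ≤ R) (ht : 0 ≤ t) (r : ℝ≥0 × Fin D) :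
    ENNReal.ofReal (Real.exp (-(R * t))) * ENNReal.ofReal (expTest θ β r) ≤
      quietOp M t (fun r => ENNReal.ofReal (expTest θ β r)) r := by
  rw [quietOp_expTest, ← ENNReal.ofReal_mul (Real.exp_pos _).le]
  exact ENNReal.ofReal_le_ofReal (hM.le_quietTest hθ hβ hR ht r)

theorem Params.IsAdmissible.quietOp_eventOp_quietOp_expTest_le (hM : M.IsAdmissible) (hθ : 0 ≤ θ)
    (hβ : 0 ≤ β) (hR : ∀ d, eventRate M d + θ * M.cap d ≤ R) {s : ℝ} (hs : s ∈ Set.Icc 0 t)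
    (r : ℝ≥0 × Fin D) :
    quietOp M s (eventOp M (quietOp M (t - s) fun r => ENNReal.ofReal (expTest θ β r))) r ≤
      ENNReal.ofReal (Real.exp (R * t)) * ENNReal.ofReal (expTest θ (M.eventGain θ β) r) := by
  calc quietOp M s (eventOp M (quietOp M (t - s) fun r => ENNReal.ofReal (expTest θ β r))) r
      ≤ quietOp M s (fun r => ENNReal.ofReal (Real.exp (R * (t - s))) *
          ENNReal.ofReal (expTest θ (M.eventGain θ β) r)) r := by
        refine quietOp_mono M s (fun r' => ?_) r
        rw [← hM.eventOp_expTest hθ hβ, ← eventOp_const_mul M ENNReal.ofReal_ne_top]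
        exact eventOp_mono M (hM.quietOp_expTest_le hθ hβ hR (sub_nonneg.2 hs.2)) r'
    _ ≤ ENNReal.ofReal (Real.exp (R * (t - s))) * (ENNReal.ofReal (Real.exp (R * s)) *
          ENNReal.ofReal (expTest θ (M.eventGain θ β) r)) := by
        rw [quietOp_const_mul]
        exact mul_le_mul_right
          (hM.quietOp_expTest_le hθ (hM.eventGain_nonneg θ hβ) hR hs.1 r) _
    _ = ENNReal.ofReal (Real.exp (R * t)) *
          ENNReal.ofReal (expTest θ (M.eventGain θ β) r) := by
        rw [← mul_assoc, ← ENNReal.ofReal_mul (Real.exp_pos _).le, ← Real.exp_add, ← mul_add,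
          sub_add_cancel]

theorem Params.IsAdmissible.le_quietOp_eventOp_quietOp_expTest (hM : M.IsAdmissible) (hθ : 0 ≤ θ)
    (hβ : 0 ≤ β) (hR : ∀ d, eventRate M d + θ * M.cap d ≤ R) {s : ℝ} (hs : s ∈ Set.Icc 0 t)
    (r : ℝ≥0 × Fin D) :
    ENNReal.ofReal (Real.exp (-(R * t))) * ENNReal.ofReal (expTest θ (M.eventGain θ β) r) ≤
      quietOp M s (eventOp M (quietOp M (t - s) fun r => ENNReal.ofReal (expTest θ β r))) r := by
  calc ENNReal.ofReal (Real.exp (-(R * t))) * ENNReal.ofReal (expTest θ (M.eventGain θ β) r)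
      = ENNReal.ofReal (Real.exp (-(R * (t - s)))) * (ENNReal.ofReal (Real.exp (-(R * s))) *
          ENNReal.ofReal (expTest θ (M.eventGain θ β) r)) := by
        rw [← mul_assoc, ← ENNReal.ofReal_mul (Real.exp_nonneg (-(R * (t - s)))), ← Real.exp_add,
          ← neg_add, ← mul_add, sub_add_cancel]
    _ ≤ quietOp M s (fun r => ENNReal.ofReal (Real.exp (-(R * (t - s)))) *
          ENNReal.ofReal (expTest θ (M.eventGain θ β) r)) r := by
        rw [quietOp_const_mul]
        exact mul_le_mul_right
          (hM.le_quietOp_expTest hθ (hM.eventGain_nonneg θ hβ) hR hs.1 r) _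
    _ ≤ quietOp M s (eventOp M (quietOp M (t - s) fun r => ENNReal.ofReal (expTest θ β r))) r := by
        refine quietOp_mono M s (fun r' => ?_) r
        rw [← hM.eventOp_expTest hθ hβ, ← eventOp_const_mul M ENNReal.ofReal_ne_top]
        exact eventOp_mono M (hM.le_quietOp_expTest hθ hβ hR (sub_nonneg.2 hs.2)) r'

theorem Params.IsAdmissible.dyson_one_expTest_le (hM : M.IsAdmissible) (hθ : 0 ≤ θ) (hβ : 0 ≤ β)
    (hR : ∀ d, eventRate M d + θ * M.cap d ≤ R) (ht : 0 ≤ t) (r : ℝ≥0 × Fin D) :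
    dyson M 1 t (fun r => ENNReal.ofReal (expTest θ β r)) r ≤
      ENNReal.ofReal (t * Real.exp (R * t) * expTest θ (M.eventGain θ β) r) := by
  calc dyson M 1 t (fun r => ENNReal.ofReal (expTest θ β r)) r
      ≤ ∫⁻ _ in Set.Icc 0 t,
          ENNReal.ofReal (Real.exp (R * t)) * ENNReal.ofReal (expTest θ (M.eventGain θ β) r) :=
        setLIntegral_mono' measurableSet_Icc fun _ hs =>
          hM.quietOp_eventOp_quietOp_expTest_le hθ hβ hR hs r
    _ = ENNReal.ofReal (t * Real.exp (R * t) * expTest θ (M.eventGain θ β) r) := by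
        rw [setLIntegral_const, Real.volume_Icc, sub_zero, mul_comm, ← mul_assoc,
          ← ENNReal.ofReal_mul ht, ← ENNReal.ofReal_mul (by positivity)]

theorem Params.IsAdmissible.le_dyson_one_expTest (hM : M.IsAdmissible) (hθ : 0 ≤ θ) (hβ : 0 ≤ β)
    (hR : ∀ d, eventRate M d + θ * M.cap d ≤ R) (ht : 0 ≤ t) (r : ℝ≥0 × Fin D) :
    ENNReal.ofReal (t * Real.exp (-(R * t)) * expTest θ (M.eventGain θ β) r) ≤
      dyson M 1 t (fun r => ENNReal.ofReal (expTest θ β r)) r := by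
  calc ENNReal.ofReal (t * Real.exp (-(R * t)) * expTest θ (M.eventGain θ β) r)
      = ∫⁻ _ in Set.Icc 0 t, ENNReal.ofReal (Real.exp (-(R * t))) *
          ENNReal.ofReal (expTest θ (M.eventGain θ β) r) := by
        rw [setLIntegral_const, Real.volume_Icc, sub_zero, mul_comm (_ * _) (ENNReal.ofReal t),
          ← mul_assoc, ← ENNReal.ofReal_mul ht, ← ENNReal.ofReal_mul (by positivity)]
    _ ≤ dyson M 1 t (fun r => ENNReal.ofReal (expTest θ β r)) r :=
        setLIntegral_mono' measurableSet_Icc fun _ hs =>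
          hM.le_quietOp_eventOp_quietOp_expTest hθ hβ hR hs r

end ExponentialTestFunctions

section Stationarity

section FiniteFibers

variable {Ω ι : Type*} [MeasurableSpace Ω] [MeasurableSpace ι] [MeasurableSingletonClass ι]
  {μ : Measure Ω} {Z : Ω → ι} {f : Ω → ℝ}

theorem integrable_comp_mul_of_finite [Finite ι] (hZ : Measurable Z) (hf : Integrable f μ)
    (γ : ι → ℝ) : Integrable (fun ω => γ (Z ω) * f ω) μ := by
  obtain ⟨C, hC⟩ := Finite.exists_le fun i => ‖γ i‖
  exact hf.bdd_mul ((measurable_of_finite γ).comp hZ).aestronglyMeasurable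
    (.of_forall fun ω => hC (Z ω))

theorem integral_comp_mul_eq_sum_setIntegral [Fintype ι] (hZ : Measurable Z)
    (hf : Integrable f μ) (γ : ι → ℝ) :
    ∫ ω, γ (Z ω) * f ω ∂μ = ∑ i, γ i * ∫ ω in {ω | Z ω = i}, f ω ∂μ := by
  have hmeas : ∀ i, MeasurableSet {ω | Z ω = i} := fun i => hZ (measurableSet_singleton i)
  have hfiber : ∀ i, Set.EqOn (fun ω => γ (Z ω) * f ω) (fun ω => γ i * f ω) {ω | Z ω = i} := by
    rintro _ ω rfl
    rfl
  have hunion : ⋃ i, {ω | Z ω = i} = Set.univ :=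
    Set.iUnion_eq_univ_iff.2 fun ω => ⟨Z ω, rfl⟩
  rw [← setIntegral_univ, ← hunion, integral_iUnion_fintype hmeas
    (fun i j hij => Set.disjoint_left.2 fun ω hi hj => hij (hi.symm.trans hj))
    fun i => (integrable_comp_mul_of_finite hZ hf γ).integrableOn]
  exact Finset.sum_congr rfl fun i _ => by
    rw [setIntegral_congr_fun (hmeas i) (hfiber i), integral_const_mul]

end FiniteFibers

theorem integral_le_integral_of_lintegral_ofReal_le {Ω : Type*} [MeasurableSpace Ω] {μ : Measure Ω}
    {f g : Ω → ℝ} (hf : Integrable f μ) (hg : Integrable g μ) (hf0 : 0 ≤ f) (hg0 : 0 ≤ g)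
    (h : ∫⁻ ω, ENNReal.ofReal (f ω) ∂μ ≤ ∫⁻ ω, ENNReal.ofReal (g ω) ∂μ) :
    ∫ ω, f ω ∂μ ≤ ∫ ω, g ω ∂μ := by
  rwa [← ofReal_integral_eq_lintegral_ofReal hf (.of_forall hf0),
    ← ofReal_integral_eq_lintegral_ofReal hg (.of_forall hg0),
    ENNReal.ofReal_le_ofReal_iff (integral_nonneg hg0)] at h

variable {D : ℕ} {K : Type*} [MeasurableSpace K] {M : Params D K} {S : ServiceDiscipline K}
  {μ : Measure (S.State × Fin D)} {θ : ℝ} {β : Fin D → ℝ}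

/-- The Laplace transform, at `θ`, of the workload on the event that the environment is in state
`d`. -/
noncomputable def workloadLaplace (S : ServiceDiscipline K) (μ : Measure (S.State × Fin D)) (θ : ℝ)
    (d : Fin D) : ℝ :=
  mgf (fun q => (S.workload q.1 : ℝ)) (μ.restrict {q | q.2 = d}) (-θ)

/-- The probability `p_{0,d}` that the queue is empty and the environment is in state `d`. -/
noncomputable def idleProb (S : ServiceDiscipline K) (μ : Measure (S.State × Fin D)) (d : Fin D) :
    ℝ :=
  μ.real {q | S.workload q.1 = 0 ∧ q.2 = d}

/-- The Laplace exponent `θ ↦ c_d θ - λ_d (1 - E e^{-θ B_d})` of the net input process in the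
environment `d`. -/
noncomputable def Params.laplaceExponent (M : Params D K) (θ : ℝ) (d : Fin D) : ℝ :=
  M.cap d * θ - M.rate d * (1 - M.serviceLaplace θ d)

theorem measurable_workload_fst :
    Measurable fun q : S.State × Fin D => (S.workload q.1 : ℝ) :=
  measurable_coe_nnreal_real.comp (S.measurable_workload.comp measurable_fst)

theorem measurable_workload_env :
    Measurable fun q : S.State × Fin D => (S.workload q.1, q.2) :=
  (S.measurable_workload.comp measurable_fst).prodMk measurable_snd

theorem integrable_exp_neg_mul_workload [IsFiniteMeasure μ] (hθ : 0 ≤ θ) :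
    Integrable (fun q => Real.exp (-θ * S.workload q.1)) μ :=
  integrable_exp_neg_mul measurable_workload_fst.aemeasurable
    (.of_forall fun _ => NNReal.coe_nonneg _) hθ

theorem integrable_expTest [IsFiniteMeasure μ] (hθ : 0 ≤ θ) (β : Fin D → ℝ) :
    Integrable (fun q => expTest θ β (S.workload q.1, q.2)) μ :=
  integrable_comp_mul_of_finite measurable_snd (integrable_exp_neg_mul_workload hθ) β

theorem integral_expTest [IsFiniteMeasure μ] (hθ : 0 ≤ θ) (β : Fin D → ℝ) :
    ∫ q, expTest θ β (S.workload q.1, q.2) ∂μ = ∑ d, β d * workloadLaplace S μ θ d :=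
  integral_comp_mul_eq_sum_setIntegral measurable_snd (integrable_exp_neg_mul_workload hθ) β

theorem measurableSet_idle : MeasurableSet {q : S.State × Fin D | S.workload q.1 = 0} :=
  (S.measurable_workload.comp measurable_fst) (measurableSet_singleton 0)

theorem integrable_indicator_idle [IsFiniteMeasure μ] :
    Integrable ({q : S.State × Fin D | S.workload q.1 = 0}.indicator (1 : S.State × Fin D → ℝ)) μ :=
  (integrable_const 1).indicator measurableSet_idle

theorem integral_comp_mul_indicator_idle [IsFiniteMeasure μ] (β : Fin D → ℝ) :
    ∫ q : S.State × Fin D, β q.2 * {q | S.workload q.1 = 0}.indicator 1 q ∂μ =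
      ∑ d, β d * idleProb S μ d := by
  rw [integral_comp_mul_eq_sum_setIntegral measurable_snd integrable_indicator_idle β]
  refine Finset.sum_congr rfl fun d _ => congrArg (β d * ·) ?_
  rw [integral_indicator_one measurableSet_idle, measureReal_restrict_apply measurableSet_idle]
  rfl

theorem measurable_quietTest (t : ℝ) : Measurable (quietTest M θ β t) := by
  have hcap : Measurable fun r : ℝ≥0 × Fin D => (M.cap r.2 * t).toNNReal :=
    (measurable_of_finite fun d => (M.cap d * t).toNNReal).comp measurable_snd
  exact ((measurable_of_finite fun d => Real.exp (-(eventRate M d * t))).comp measurable_snd).mul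
    ((measurable_expTest θ β).comp ((measurable_fst.sub hcap).prodMk measurable_snd))

theorem Params.IsAdmissible.integrable_quietTest [IsFiniteMeasure μ] (hM : M.IsAdmissible)
    (hθ : 0 ≤ θ) (hβ : 0 ≤ β) {t : ℝ} (ht : 0 ≤ t) :
    Integrable (fun q => quietTest M θ β t (S.workload q.1, q.2)) μ := by
  refine .of_mem_Icc 0 (∑ d, β d)
    ((measurable_quietTest t).comp measurable_workload_env).aemeasurable
    (.of_forall fun q => ⟨quietTest_nonneg hβ t _, ?_⟩)
  refine (mul_le_of_le_one_left (expTest_nonneg hβ _) (Real.exp_le_one_iff.2 ?_)).trans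
    (expTest_le_sum hθ hβ _)
  exact neg_nonpos.2 (mul_nonneg (hM.eventRate_nonneg _) ht)

variable {R t : ℝ}

theorem IsSteadyState.lintegral_tsum_dyson (h : IsSteadyState M S μ) (ht : 0 ≤ t) (θ : ℝ)
    (β : Fin D → ℝ) :
    ∫⁻ q, ∑' n, dyson M n t (fun r => ENNReal.ofReal (expTest θ β r)) (S.workload q.1, q.2) ∂μ =
      ∫⁻ q, ENNReal.ofReal (expTest θ β (S.workload q.1, q.2)) ∂μ := by
  rw [← h.stationary t ht _ (measurable_expTest θ β).ennreal_ofReal]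
  exact lintegral_congr fun q => (transition_comp_workload S M _ t q).symm

theorem IsSteadyState.integral_quietTest_add_le (h : IsSteadyState M S μ) (hM : M.IsAdmissible)
    (hθ : 0 ≤ θ) (hβ : 0 ≤ β) (hR : ∀ d, eventRate M d + θ * M.cap d ≤ R) (ht : 0 ≤ t) :
    ∫ q, quietTest M θ β t (S.workload q.1, q.2) ∂μ +
        t * Real.exp (-(R * t)) * ∫ q, expTest θ (M.eventGain θ β) (S.workload q.1, q.2) ∂μ ≤
      ∫ q, expTest θ β (S.workload q.1, q.2) ∂μ := by
  have := h.prob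
  have hquiet := hM.integrable_quietTest (S := S) (μ := μ) hθ hβ ht
  have hgain := (integrable_expTest (S := S) (μ := μ) hθ (M.eventGain θ β)).const_mul
    (t * Real.exp (-(R * t)))
  have hgain0 : ∀ r, 0 ≤ t * Real.exp (-(R * t)) * expTest θ (M.eventGain θ β) r := fun r =>
    mul_nonneg (by positivity) (expTest_nonneg (hM.eventGain_nonneg θ hβ) r)
  rw [← integral_const_mul, ← integral_add hquiet hgain]
  refine integral_le_integral_of_lintegral_ofReal_le (hquiet.add hgain) (integrable_expTest hθ β)
    (fun q => add_nonneg (quietTest_nonneg hβ t _) (hgain0 _)) (fun q => expTest_nonneg hβ _) ?_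
  rw [← h.lintegral_tsum_dyson ht]
  refine lintegral_mono fun q => le_trans ?_ (le_tsum_dyson t _ _)
  rw [ENNReal.ofReal_add (quietTest_nonneg hβ t _) (hgain0 _), dyson, quietOp_expTest]
  gcongr
  exact hM.le_dyson_one_expTest hθ hβ hR ht _

theorem IsSteadyState.le_integral_quietTest_add (h : IsSteadyState M S μ) (hM : M.IsAdmissible)
    (hθ : 0 ≤ θ) (hβ : 0 ≤ β) (hR : ∀ d, eventRate M d + θ * M.cap d ≤ R) (ht : 0 ≤ t)
    (hRt : R * t ≤ 1 / 2) :
    ∫ q, expTest θ β (S.workload q.1, q.2) ∂μ ≤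
      ∫ q, quietTest M θ β t (S.workload q.1, q.2) ∂μ +
        t * Real.exp (R * t) * ∫ q, expTest θ (M.eventGain θ β) (S.workload q.1, q.2) ∂μ +
        2 * (R * t) ^ 2 * ∑ d, β d := by
  have := h.prob
  have hrate : ∀ d, eventRate M d ≤ R := fun d => by
    linarith [hR d, mul_nonneg hθ (hM.cap_nonneg d)]
  have hquiet := hM.integrable_quietTest (S := S) (μ := μ) hθ hβ ht
  have hgain := (integrable_expTest (S := S) (μ := μ) hθ (M.eventGain θ β)).const_mul
    (t * Real.exp (R * t))
  have hgain0 : ∀ r, 0 ≤ t * Real.exp (R * t) * expTest θ (M.eventGain θ β) r := fun r =>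
    mul_nonneg (by positivity) (expTest_nonneg (hM.eventGain_nonneg θ hβ) r)
  have htail0 : 0 ≤ 2 * (R * t) ^ 2 * ∑ d, β d :=
    mul_nonneg (by positivity) (Finset.sum_nonneg fun d _ => hβ d)
  have hsum0 : ∀ r, 0 ≤ quietTest M θ β t r +
      t * Real.exp (R * t) * expTest θ (M.eventGain θ β) r := fun r =>
    add_nonneg (quietTest_nonneg hβ t r) (hgain0 r)
  have hsum : Integrable (fun q => quietTest M θ β t (S.workload q.1, q.2) +
      t * Real.exp (R * t) * expTest θ (M.eventGain θ β) (S.workload q.1, q.2)) μ :=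
    hquiet.add hgain
  have htail : ∫ _, 2 * (R * t) ^ 2 * ∑ d, β d ∂μ = 2 * (R * t) ^ 2 * ∑ d, β d := by simp
  rw [← integral_const_mul, ← integral_add hquiet hgain, ← htail,
    ← integral_add hsum (integrable_const _)]
  refine integral_le_integral_of_lintegral_ofReal_le (integrable_expTest hθ β)
    (hsum.add (integrable_const _)) (fun q => expTest_nonneg hβ _)
    (fun q => add_nonneg (hsum0 _) htail0) ?_
  rw [← h.lintegral_tsum_dyson ht]
  refine lintegral_mono fun q => (hM.tsum_dyson_le hrate
    (fun r => ENNReal.ofReal_le_ofReal (expTest_le_sum hθ hβ r)) ht hRt _).trans ?_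
  rw [ENNReal.ofReal_add (hsum0 _) htail0, ENNReal.ofReal_add (quietTest_nonneg hβ t _) (hgain0 _),
    ENNReal.ofReal_mul (by positivity : 0 ≤ 2 * (R * t) ^ 2), dyson, quietOp_expTest]
  gcongr
  exact hM.dyson_one_expTest_le hθ hβ hR ht _

end Stationarity

section Balance

variable {D : ℕ} {K : Type*} [MeasurableSpace K] {M : Params D K} {S : ServiceDiscipline K}
  {μ : Measure (S.State × Fin D)} {θ : ℝ} {β : Fin D → ℝ}

theorem eventually_mul_le_nhdsGT_zero (R : ℝ) {c : ℝ} (hc : 0 < c) :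
    ∀ᶠ t in 𝓝[>] 0, R * t ≤ c :=
  (((continuous_const_mul R).tendsto' 0 0 (mul_zero R)).mono_left
    nhdsWithin_le_nhds).eventually_le_const hc

theorem Params.IsAdmissible.eventually_quietTest_eq (hM : M.IsAdmissible) (θ : ℝ)
    (β : Fin D → ℝ) (r : ℝ≥0 × Fin D) :
    ∀ᶠ t in 𝓝[>] 0, quietTest M θ β t r =
      Real.exp (-t * (eventRate M r.2 - θ * if r.1 = 0 then 0 else M.cap r.2)) *
        expTest θ β r := by
  obtain ⟨w, d⟩ := r
  by_cases hw : w = 0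
  · refine .of_forall fun t => ?_
    simp only [quietTest, hw, zero_tsub, if_true, mul_zero, sub_zero, neg_mul,
      mul_comm t]
  · filter_upwards [eventually_mul_le_nhdsGT_zero (M.cap d) (NNReal.coe_pos.2
      (pos_iff_ne_zero.2 hw)), self_mem_nhdsWithin] with t hle ht
    have hb := Real.coe_toNNReal _ (mul_nonneg (hM.cap_nonneg d) (le_of_lt ht))
    rw [quietTest, expTest, expTest, NNReal.coe_sub (Real.toNNReal_le_iff_le_coe.2 hle), hb,
      if_neg hw, mul_left_comm, ← Real.exp_add, mul_left_comm (Real.exp _), ← Real.exp_add]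
    ring_nf

theorem Params.IsAdmissible.tendsto_expTest_sub_quietTest_div (hM : M.IsAdmissible) (θ : ℝ)
    (β : Fin D → ℝ) (r : ℝ≥0 × Fin D) :
    Tendsto (fun t => (expTest θ β r - quietTest M θ β t r) / t) (𝓝[>] 0)
      (𝓝 ((eventRate M r.2 - θ * if r.1 = 0 then 0 else M.cap r.2) * expTest θ β r)) := by
  refine ((tendsto_one_sub_exp_neg_mul_div _).mul_const _).congr' ?_
  filter_upwards [hM.eventually_quietTest_eq θ β r] with t ht
  rw [ht]
  ring

theorem Params.IsAdmissible.abs_expTest_sub_quietTest_le (hM : M.IsAdmissible) (hθ : 0 ≤ θ)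
    (hβ : 0 ≤ β) {R t : ℝ} (hR : ∀ d, eventRate M d + θ * M.cap d ≤ R) (ht : 0 ≤ t)
    (hRt : R * t ≤ 1) (r : ℝ≥0 × Fin D) :
    |expTest θ β r - quietTest M θ β t r| ≤ 2 * R * (∑ d, β d) * t := by
  have hE := expTest_nonneg (θ := θ) hβ r
  have hRt0 : 0 ≤ R * t := mul_nonneg
    ((add_nonneg (hM.eventRate_nonneg r.2) (mul_nonneg hθ (hM.cap_nonneg r.2))).trans (hR r.2)) ht
  have hexp : Real.exp (R * t) - 1 ≤ 2 * (R * t) := by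
    have := Real.abs_exp_sub_one_le (abs_le.2 ⟨by linarith, hRt⟩)
    rw [abs_of_nonneg hRt0] at this
    exact (le_abs_self _).trans this
  have hupper := mul_le_mul_of_nonneg_right hexp hE
  have hlower := mul_le_mul_of_nonneg_right (Real.one_sub_le_exp_neg (R * t)) hE
  have hsum := mul_le_mul_of_nonneg_left (expTest_le_sum hθ hβ r) hRt0
  rw [abs_le]
  constructor <;> nlinarith [hM.quietTest_le hθ hβ hR ht r, hM.le_quietTest hθ hβ hR ht r]

theorem Params.IsAdmissible.tendsto_integral_sub_quietTest_div [IsFiniteMeasure μ]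
    (hM : M.IsAdmissible) (hθ : 0 ≤ θ) (hβ : 0 ≤ β) :
    Tendsto (fun t => ∫ q, (expTest θ β (S.workload q.1, q.2) -
        quietTest M θ β t (S.workload q.1, q.2)) / t ∂μ) (𝓝[>] 0)
      (𝓝 (∫ q, (eventRate M q.2 - θ * if S.workload q.1 = 0 then 0 else M.cap q.2) *
        expTest θ β (S.workload q.1, q.2) ∂μ)) := by
  obtain ⟨R, hR⟩ := Finite.exists_le fun d => eventRate M d + θ * M.cap d
  refine tendsto_integral_filter_of_dominated_convergence (fun _ => 2 * R * ∑ d, β d)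
    (.of_forall fun t => ?_) ?_ (integrable_const _)
    (.of_forall fun q => hM.tendsto_expTest_sub_quietTest_div θ β (S.workload q.1, q.2))
  · exact ((((measurable_expTest θ β).sub (measurable_quietTest t)).comp
      measurable_workload_env).div_const t).aestronglyMeasurable
  · filter_upwards [self_mem_nhdsWithin, eventually_mul_le_nhdsGT_zero R one_pos]
      with t (ht : 0 < t) hRt
    refine .of_forall fun q => ?_
    rw [Real.norm_eq_abs, abs_div, abs_of_pos ht, div_le_iff₀ ht]
    exact hM.abs_expTest_sub_quietTest_le hθ hβ hR ht.le hRt _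

theorem IsSteadyState.tendsto_integral_sub_quietTest_div (h : IsSteadyState M S μ)
    (hM : M.IsAdmissible) (hθ : 0 ≤ θ) (hβ : 0 ≤ β) :
    Tendsto (fun t => ∫ q, (expTest θ β (S.workload q.1, q.2) -
        quietTest M θ β t (S.workload q.1, q.2)) / t ∂μ) (𝓝[>] 0)
      (𝓝 (∫ q, expTest θ (M.eventGain θ β) (S.workload q.1, q.2) ∂μ)) := by
  have := h.prob
  obtain ⟨R, hR⟩ := Finite.exists_le fun d => eventRate M d + θ * M.cap d
  set I := ∫ q, expTest θ (M.eventGain θ β) (S.workload q.1, q.2) ∂μ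
  have hlower : Tendsto (fun t => Real.exp (-(R * t)) * I) (𝓝[>] 0) (𝓝 I) := by
    have hc : Continuous fun t => Real.exp (-(R * t)) * I := by fun_prop
    simpa using (hc.tendsto 0).mono_left nhdsWithin_le_nhds
  have hupper : Tendsto (fun t => Real.exp (R * t) * I + 2 * R ^ 2 * (∑ d, β d) * t) (𝓝[>] 0)
      (𝓝 I) := by
    have hc : Continuous fun t => Real.exp (R * t) * I + 2 * R ^ 2 * (∑ d, β d) * t := by
      fun_prop
    simpa using (hc.tendsto 0).mono_left nhdsWithin_le_nhds
  refine tendsto_of_tendsto_of_tendsto_of_le_of_le' hlower hupper ?_ ?_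
  · filter_upwards [self_mem_nhdsWithin] with t (ht : 0 < t)
    rw [integral_div, integral_sub (integrable_expTest hθ β)
      (hM.integrable_quietTest hθ hβ ht.le), le_div_iff₀ ht]
    linarith [h.integral_quietTest_add_le hM hθ hβ hR ht.le]
  · filter_upwards [self_mem_nhdsWithin, eventually_mul_le_nhdsGT_zero R one_half_pos]
      with t (ht : 0 < t) hRt
    rw [integral_div, integral_sub (integrable_expTest hθ β)
      (hM.integrable_quietTest hθ hβ ht.le), div_le_iff₀ ht]
    linarith [h.le_integral_quietTest_add hM hθ hβ hR ht.le hRt]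

theorem integral_eventRate_sub_mul_expTest [IsFiniteMeasure μ] (hθ : 0 ≤ θ) (β : Fin D → ℝ) :
    ∫ q, (eventRate M q.2 - θ * if S.workload q.1 = 0 then 0 else M.cap q.2) *
        expTest θ β (S.workload q.1, q.2) ∂μ =
      ∑ d, (eventRate M d - θ * M.cap d) * β d * workloadLaplace S μ θ d +
        ∑ d, θ * M.cap d * β d * idleProb S μ d := by
  rw [← integral_expTest hθ, ← integral_comp_mul_indicator_idle, ← integral_add
    (integrable_expTest hθ _) (integrable_comp_mul_of_finite measurable_snd
      integrable_indicator_idle fun d => θ * M.cap d * β d)]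
  refine integral_congr_ae (.of_forall fun q => ?_)
  by_cases hq : S.workload q.1 = 0
  · simp only [hq, ↓reduceIte, mul_zero, sub_zero, expTest, NNReal.coe_zero, Real.exp_zero, mul_one,
      Set.mem_ofPred_eq, Set.indicator_of_mem, Pi.one_apply]
    ring
  · simp only [hq, ↓reduceIte, expTest, neg_mul, Set.mem_ofPred_eq, not_false_eq_true,
      Set.indicator_of_notMem, mul_zero, add_zero]
    ring

theorem IsSteadyState.sum_laplaceExponent_add_mulVec_mul_workloadLaplace
    (h : IsSteadyState M S μ) (hM : M.IsAdmissible) (hθ : 0 ≤ θ) (hβ : 0 ≤ β) :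
    ∑ d, (M.laplaceExponent θ d * β d + M.gen.mulVec β d) * workloadLaplace S μ θ d =
      θ * ∑ d, M.cap d * β d * idleProb S μ d := by
  have := h.prob
  have hbal := tendsto_nhds_unique (hM.tendsto_integral_sub_quietTest_div (S := S) (μ := μ) hθ hβ)
    (h.tendsto_integral_sub_quietTest_div hM hθ hβ)
  rw [integral_eventRate_sub_mul_expTest hθ, integral_expTest hθ] at hbal
  have hgain : ∀ d, M.eventGain θ β d =
      M.rate d * M.serviceLaplace θ d * β d + (M.gen.mulVec β d - M.gen d d * β d) := fun d => by
    rw [Params.eventGain, Matrix.mulVec, dotProduct, ← Finset.add_sum_erase _ _ (Finset.mem_univ d),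
      add_sub_cancel_left]
  rw [Finset.mul_sum, ← sub_eq_zero]
  rw [← sub_eq_zero, ← Finset.sum_add_distrib, ← Finset.sum_sub_distrib] at hbal
  rw [← Finset.sum_sub_distrib, ← neg_eq_zero, ← Finset.sum_neg_distrib, ← hbal]
  refine Finset.sum_congr rfl fun d _ => ?_
  rw [hgain, hM.eventRate_eq, Params.laplaceExponent]
  ring

end Balance

section Moments

open scoped Matrix

variable {D : ℕ} {K : Type*} [MeasurableSpace K] {M : Params D K} {S : ServiceDiscipline K}
  {μ : Measure (S.State × Fin D)} {θ : ℝ} {p : Fin D → ℝ}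

/-- The mean rate `c_d - λ_d h_{d1}` at which the workload of a busy queue decreases in the
environment `d`. -/
noncomputable def Params.netDrain (M : Params D K) (d : Fin D) : ℝ :=
  M.cap d - M.rate d * M.h1 d

theorem Params.IsAdmissible.integrable_service (hM : M.IsAdmissible) (d : Fin D) :
    Integrable (fun z : K × ℝ≥0 => (z.2 : ℝ)) (M.customerLaw d) := by
  have := hM.prob d
  exact ((memLp_two_iff_integrable_sq (by fun_prop)).2 (hM.second_moment d)).integrable one_le_two

theorem Params.IsAdmissible.tendsto_laplaceExponent_div (hM : M.IsAdmissible) (d : Fin D) :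
    Tendsto (fun θ => M.laplaceExponent θ d / θ) (𝓝[>] 0) (𝓝 (M.netDrain d)) := by
  have := hM.prob d
  have hlim := tendsto_measureReal_univ_sub_mgf_neg_div (hM.integrable_service d)
    (.of_forall fun z => z.2.2)
  refine ((hlim.const_mul (M.rate d)).const_sub (M.cap d)).congr' ?_
  filter_upwards [self_mem_nhdsWithin] with θ (hθ : 0 < θ)
  rw [probReal_univ, laplaceExponent, serviceLaplace]
  field_simp

theorem Params.IsAdmissible.tendsto_laplaceExponent_sub_div_sq (hM : M.IsAdmissible) (d : Fin D) :
    Tendsto (fun θ => (M.laplaceExponent θ d - θ * M.netDrain d) / θ ^ 2) (𝓝[>] 0)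
      (𝓝 (M.rate d * M.h2 d / 2)) := by
  have := hM.prob d
  have hlim := tendsto_mgf_neg_sub_affine_div_sq (hM.integrable_service d).aemeasurable
    (.of_forall fun z => z.2.2) (hM.second_moment d)
  rw [mul_div_assoc]
  refine (hlim.const_mul (M.rate d)).congr fun θ => ?_
  rw [probReal_univ, laplaceExponent, serviceLaplace, netDrain, h1]
  ring

theorem IsSteadyState.vecMul_workloadLaplace (h : IsSteadyState M S μ) (hM : M.IsAdmissible)
    (hθ : 0 ≤ θ) (k : Fin D) :
    (workloadLaplace S μ θ ᵥ* M.gen) k =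
      θ * (M.cap k * idleProb S μ k) - M.laplaceExponent θ k * workloadLaplace S μ θ k := by
  have hbal := h.sum_laplaceExponent_add_mulVec_mul_workloadLaplace hM hθ
    (β := Pi.single k 1) (Pi.single_nonneg.2 zero_le_one)
  simp only [Matrix.mulVec_single_one, Matrix.col_apply, add_mul, Finset.sum_add_distrib,
    Pi.single_apply, mul_ite, ite_mul, mul_one, mul_zero, zero_mul, Finset.sum_ite_eq',
    Finset.mem_univ, if_true] at hbal
  rw [← hbal, add_sub_cancel_left]
  simp only [Matrix.vecMul, dotProduct, mul_comm]

theorem IsSteadyState.workloadLaplace_dotProduct_mulVec (h : IsSteadyState M S μ)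
    (hM : M.IsAdmissible) (hθ : 0 ≤ θ) (b : Fin D → ℝ) :
    workloadLaplace S μ θ ⬝ᵥ M.gen *ᵥ b =
      ∑ k, (θ * (M.cap k * idleProb S μ k) -
        M.laplaceExponent θ k * workloadLaplace S μ θ k) * b k := by
  rw [Matrix.dotProduct_mulVec]
  exact Finset.sum_congr rfl fun k _ => by rw [h.vecMul_workloadLaplace hM hθ]

theorem sum_workloadLaplace [IsFiniteMeasure μ] (hθ : 0 ≤ θ) :
    ∑ d, workloadLaplace S μ θ d = mgf (fun q => (S.workload q.1 : ℝ)) μ (-θ) := by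
  simpa [expTest, mgf] using (integral_expTest (S := S) (μ := μ) hθ 1).symm

theorem IsSteadyState.workloadLaplace_zero (h : IsSteadyState M S μ) (hM : M.IsAdmissible)
    (hp : IsInvariant M.gen p) : workloadLaplace S μ 0 = p := by
  have := h.prob
  refine hp.eq_of_vecMul_eq_zero hM.generator hM.irreducible ?_ (funext fun k => ?_)
  · rw [sum_workloadLaplace le_rfl, neg_zero, mgf_zero]
  · have := hM.prob k
    rw [h.vecMul_workloadLaplace hM le_rfl, Params.laplaceExponent, Params.serviceLaplace, neg_zero,
      mgf_zero]
    simp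

theorem IsSteadyState.tendsto_workloadLaplace_nhdsGT_zero (h : IsSteadyState M S μ)
    (hM : M.IsAdmissible) (hp : IsInvariant M.gen p) (d : Fin D) :
    Tendsto (fun θ => workloadLaplace S μ θ d) (𝓝[>] 0) (𝓝 (p d)) := by
  have := h.prob
  rw [← h.workloadLaplace_zero hM hp, workloadLaplace, neg_zero, mgf_zero']
  exact tendsto_mgf_neg_nhdsGT_zero measurable_workload_fst.aemeasurable
    (.of_forall fun _ => NNReal.coe_nonneg _)

theorem measureReal_restrict_workload_eq_zero (d : Fin D) :
    (μ.restrict {q | q.2 = d}).real {q | (S.workload q.1 : ℝ) = 0} = idleProb S μ d := by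
  simp only [NNReal.coe_eq_zero]
  rw [measureReal_restrict_apply measurableSet_idle]
  rfl

theorem tendsto_workloadLaplace_atTop [IsFiniteMeasure μ] (d : Fin D) :
    Tendsto (fun θ => workloadLaplace S μ θ d) atTop (𝓝 (idleProb S μ d)) := by
  rw [← measureReal_restrict_workload_eq_zero]
  exact tendsto_mgf_neg_atTop measurable_workload_fst (.of_forall fun _ => NNReal.coe_nonneg _)

theorem idleProb_le_workloadLaplace [IsFiniteMeasure μ] (hθ : 0 ≤ θ) (d : Fin D) :
    idleProb S μ d ≤ workloadLaplace S μ θ d := by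
  have hle := measure_le_le_exp_mul_mgf (μ := μ.restrict {q | q.2 = d}) 0 (neg_nonpos.2 hθ)
    (integrable_exp_neg_mul_workload hθ)
  rw [mul_zero, Real.exp_zero, one_mul] at hle
  refine le_trans ?_ hle
  rw [← measureReal_restrict_workload_eq_zero]
  exact measureReal_mono fun q hq => le_of_eq hq

theorem IsSteadyState.vecMul_idleProb_le (h : IsSteadyState M S μ) (hM : M.IsAdmissible)
    (k : Fin D) : (idleProb S μ ᵥ* M.gen) k ≤ M.rate k * idleProb S μ k := by
  have := h.prob
  have hflow : Tendsto (fun θ => (workloadLaplace S μ θ ᵥ* M.gen) k) atTop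
      (𝓝 ((idleProb S μ ᵥ* M.gen) k)) := by
    simp only [Matrix.vecMul, dotProduct]
    exact tendsto_finsetSum _ fun d _ => (tendsto_workloadLaplace_atTop d).mul_const (M.gen d k)
  refine le_of_tendsto_of_tendsto hflow ((tendsto_workloadLaplace_atTop k).const_mul (M.rate k)) ?_
  filter_upwards [eventually_ge_atTop 0] with θ hθ
  refine (h.vecMul_workloadLaplace hM hθ k).trans_le ?_
  have hidle := mul_le_mul_of_nonneg_left (idleProb_le_workloadLaplace (S := S) (μ := μ) hθ k)
    (mul_nonneg hθ (hM.cap_nonneg k))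
  have hservice : 0 ≤ M.rate k * M.serviceLaplace θ k * workloadLaplace S μ θ k :=
    mul_nonneg (mul_nonneg (hM.rate_nonneg k) mgf_nonneg) mgf_nonneg
  rw [Params.laplaceExponent]
  linarith

theorem IsSteadyState.gen_mul_idleProb_le (h : IsSteadyState M S μ) (hM : M.IsAdmissible)
    {i j : Fin D} (hij : i ≠ j) :
    M.gen i j * idleProb S μ i ≤ eventRate M j * idleProb S μ j := by
  have hflow := h.vecMul_idleProb_le hM j
  rw [Matrix.vecMul, dotProduct, ← Finset.add_sum_erase _ _ (Finset.mem_univ j)] at hflow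
  have hsingle := Finset.single_le_sum (f := fun d => idleProb S μ d * M.gen d j)
    (fun d hd => mul_nonneg measureReal_nonneg
      (hM.generator.off_diag_nonneg d j (Finset.ne_of_mem_erase hd)))
    (Finset.mem_erase.2 ⟨hij, Finset.mem_univ i⟩)
  rw [hM.eventRate_eq]
  linarith

theorem IsSteadyState.sum_laplaceExponent_mul_workloadLaplace (h : IsSteadyState M S μ)
    (hM : M.IsAdmissible) (hθ : 0 ≤ θ) :
    ∑ d, M.laplaceExponent θ d * workloadLaplace S μ θ d =
      θ * ∑ d, M.cap d * idleProb S μ d := by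
  have hbal := h.workloadLaplace_dotProduct_mulVec hM hθ 1
  rw [hM.generator.mulVec_one, dotProduct_zero] at hbal
  simp only [Pi.one_apply, mul_one, Finset.sum_sub_distrib, ← Finset.mul_sum] at hbal
  linarith

theorem IsSteadyState.sum_cap_mul_idleProb (h : IsSteadyState M S μ) (hM : M.IsAdmissible)
    (hp : IsInvariant M.gen p) :
    ∑ d, M.cap d * idleProb S μ d = ∑ d, M.netDrain d * p d := by
  refine tendsto_nhds_unique (tendsto_const_nhds.congr' ?_)
    (tendsto_finsetSum _ fun d _ => (hM.tendsto_laplaceExponent_div d).mul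
      (h.tendsto_workloadLaplace_nhdsGT_zero hM hp d))
  filter_upwards [self_mem_nhdsWithin] with θ (hθ : 0 < θ)
  simp only [div_mul_eq_mul_div, ← Finset.sum_div]
  rw [h.sum_laplaceExponent_mul_workloadLaplace hM hθ.le, mul_div_cancel_left₀ _ hθ.ne']

variable {b : Fin D → ℝ} {ε : ℝ}

theorem IsSteadyState.sum_cap_mul_idleProb_eq_of_mulVec (h : IsSteadyState M S μ)
    (hM : M.IsAdmissible) (hp : IsInvariant M.gen p)
    (hb : ∀ d, (M.gen *ᵥ b) d = M.netDrain d - ε) : ∑ d, M.cap d * idleProb S μ d = ε := by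
  have hsolvable := hp.dotProduct_mulVec b
  simp only [dotProduct, hb, mul_sub, Finset.sum_sub_distrib, ← Finset.sum_mul, hp.sum_eq_one,
    one_mul] at hsolvable
  rw [h.sum_cap_mul_idleProb hM hp, ← sub_eq_zero.1 hsolvable]
  exact Finset.sum_congr rfl fun d _ => mul_comm _ _

/- Weighting the balance equations by a solution `b` of the Poisson equation cancels the first-order
terms, so that dividing by `θ ^ 2` still leaves a finite limit as `θ → 0`. -/
theorem IsSteadyState.mul_one_sub_mgf_div (h : IsSteadyState M S μ) (hM : M.IsAdmissible)
    (hp : IsInvariant M.gen p) (hb : ∀ d, (M.gen *ᵥ b) d = M.netDrain d - ε) (hθ : 0 < θ) :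
    ε * ((1 - mgf (fun q => (S.workload q.1 : ℝ)) μ (-θ)) / θ) =
      ∑ d, ((M.laplaceExponent θ d - θ * M.netDrain d) / θ ^ 2 * workloadLaplace S μ θ d +
        b d * (M.cap d * idleProb S μ d -
          M.laplaceExponent θ d / θ * workloadLaplace S μ θ d)) := by
  have := h.prob
  set Φ := workloadLaplace S μ θ
  set u := idleProb S μ
  have htotal : ∑ d, M.laplaceExponent θ d * Φ d = θ * ε := by
    rw [h.sum_laplaceExponent_mul_workloadLaplace hM hθ.le,
      h.sum_cap_mul_idleProb_eq_of_mulVec hM hp hb]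
  have hpoisson : ∑ d, M.netDrain d * Φ d - ε * ∑ d, Φ d =
      ∑ d, (θ * (M.cap d * u d) - M.laplaceExponent θ d * Φ d) * b d := by
    rw [← h.workloadLaplace_dotProduct_mulVec hM hθ.le, Finset.mul_sum, ← Finset.sum_sub_distrib]
    exact Finset.sum_congr rfl fun d _ => by rw [hb]; ring
  calc ε * ((1 - mgf (fun q => (S.workload q.1 : ℝ)) μ (-θ)) / θ)
      = (∑ d, M.laplaceExponent θ d * Φ d - θ * ∑ d, M.netDrain d * Φ d +
          θ * ∑ d, (θ * (M.cap d * u d) - M.laplaceExponent θ d * Φ d) * b d) / θ ^ 2 := by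
        rw [htotal, ← hpoisson, ← sum_workloadLaplace hθ.le]
        field_simp
        ring
    _ = _ := by
        rw [Finset.mul_sum, Finset.mul_sum, ← Finset.sum_sub_distrib, ← Finset.sum_add_distrib,
          Finset.sum_div]
        refine Finset.sum_congr rfl fun d _ => ?_
        field_simp

theorem IsSteadyState.tendsto_mul_one_sub_mgf_div (h : IsSteadyState M S μ) (hM : M.IsAdmissible)
    (hp : IsInvariant M.gen p) (hb : ∀ d, (M.gen *ᵥ b) d = M.netDrain d - ε) :
    Tendsto (fun θ => ε * ((1 - mgf (fun q => (S.workload q.1 : ℝ)) μ (-θ)) / θ)) (𝓝[>] 0)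
      (𝓝 (∑ d, (M.rate d * M.h2 d / 2 * p d +
        b d * (M.cap d * idleProb S μ d - M.netDrain d * p d)))) := by
  refine (tendsto_finsetSum _ fun d _ => ((hM.tendsto_laplaceExponent_sub_div_sq d).mul
    (h.tendsto_workloadLaplace_nhdsGT_zero hM hp d)).add
      ((((hM.tendsto_laplaceExponent_div d).mul
        (h.tendsto_workloadLaplace_nhdsGT_zero hM hp d)).const_sub _).const_mul (b d))).congr' ?_
  filter_upwards [self_mem_nhdsWithin] with θ hθ
  exact (h.mul_one_sub_mgf_div hM hp hb hθ).symm

theorem IsSteadyState.integrable_workload (h : IsSteadyState M S μ) (hM : M.IsAdmissible)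
    (hp : IsInvariant M.gen p) (hb : ∀ d, (M.gen *ᵥ b) d = M.netDrain d - ε) (hε : 0 < ε) :
    Integrable (fun q => (S.workload q.1 : ℝ)) μ := by
  have := h.prob
  refine integrable_of_tendsto_measureReal_univ_sub_mgf_neg_div
    measurable_workload_fst.aemeasurable (.of_forall fun _ => NNReal.coe_nonneg _)
    (((h.tendsto_mul_one_sub_mgf_div hM hp hb).const_mul ε⁻¹).congr fun θ => ?_)
  rw [inv_mul_cancel_left₀ hε.ne', probReal_univ]

theorem IsSteadyState.mul_integral_workload (h : IsSteadyState M S μ) (hM : M.IsAdmissible)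
    (hp : IsInvariant M.gen p) (hb : ∀ d, (M.gen *ᵥ b) d = M.netDrain d - ε) (hε : 0 < ε) :
    ε * ∫ q, (S.workload q.1 : ℝ) ∂μ =
      ∑ d, (M.rate d * M.h2 d / 2 * p d +
        b d * (M.cap d * idleProb S μ d - M.netDrain d * p d)) := by
  have := h.prob
  have hmean := tendsto_measureReal_univ_sub_mgf_neg_div (h.integrable_workload hM hp hb hε)
    (.of_forall fun _ => NNReal.coe_nonneg _)
  rw [probReal_univ] at hmean
  exact tendsto_nhds_unique (hmean.const_mul ε) (h.tendsto_mul_one_sub_mgf_div hM hp hb)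

end Moments

section HeavyTraffic

open scoped Matrix

variable {D : ℕ} {K : Type*} [MeasurableSpace K] {M : Params D K} {S : ServiceDiscipline K}
  {p : Fin D → ℝ} {N : ℝ}

theorem Params.IsAdmissible.scaled (hM : M.IsAdmissible) (hload : 0 < M.load p) (hN : 1 < N) :
    (M.scaled p N).IsAdmissible where
  generator := hM.generator
  irreducible := hM.irreducible
  rate_nonneg d := mul_nonneg (div_nonneg (hM.rate_nonneg d) hload.le)
    (sub_nonneg.2 ((div_le_one (zero_lt_one.trans hN)).2 hN.le))
  cap_nonneg := hM.cap_nonneg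
  prob := hM.prob
  second_moment := hM.second_moment

theorem Params.dotProduct_rateHat_mul_h1 (hcap : M.capAvg p ≠ 0) (hload : M.load p ≠ 0) :
    (p ⬝ᵥ fun d => M.rateHat p d * M.h1 d) = M.capAvg p := by
  have hsum : ∑ d, p d * M.rate d * M.h1 d = M.load p * M.capAvg p :=
    (div_mul_cancel₀ _ hcap).symm
  calc (p ⬝ᵥ fun d => M.rateHat p d * M.h1 d)
      = (∑ d, p d * M.rate d * M.h1 d) / M.load p := by
        rw [Finset.sum_div]
        exact Finset.sum_congr rfl fun d _ => by simp only [rateHat]; ring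
    _ = M.capAvg p := by rw [hsum, mul_div_cancel_left₀ _ hload]

theorem Params.IsAdmissible.exists_mulVec_eq_cap_sub (hM : M.IsAdmissible)
    (hp : IsInvariant M.gen p) (hcap : M.capAvg p ≠ 0) (hload : M.load p ≠ 0) :
    ∃ a : Fin D → ℝ, ∀ d, (M.gen *ᵥ a) d = M.cap d - M.rateHat p d * M.h1 d := by
  obtain ⟨a, ha⟩ := hM.generator.exists_mulVec_eq hM.irreducible hp
    (v := M.cap - fun d => M.rateHat p d * M.h1 d) (by
      rw [dotProduct_sub, dotProduct_rateHat_mul_h1 hcap hload]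
      exact sub_self _)
  exact ⟨a, congrFun ha⟩

theorem Params.IsAdmissible.exists_mulVec_eq_sub_capAvg (hM : M.IsAdmissible)
    (hp : IsInvariant M.gen p) (hcap : M.capAvg p ≠ 0) (hload : M.load p ≠ 0) :
    ∃ a : Fin D → ℝ, ∀ d, (M.gen *ᵥ a) d = M.rateHat p d * M.h1 d - M.capAvg p := by
  obtain ⟨a, ha⟩ := hM.generator.exists_mulVec_eq hM.irreducible hp
    (v := (fun d => M.rateHat p d * M.h1 d) - fun _ => M.capAvg p) (by
      rw [dotProduct_sub, dotProduct_rateHat_mul_h1 hcap hload, dotProduct, ← Finset.sum_mul,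
        hp.sum_eq_one, one_mul, sub_self])
  exact ⟨a, congrFun ha⟩

variable {a a' : Fin D → ℝ}

theorem Params.scaled_mulVec_add_smul
    (ha : ∀ d, (M.gen *ᵥ a) d = M.cap d - M.rateHat p d * M.h1 d)
    (ha' : ∀ d, (M.gen *ᵥ a') d = M.rateHat p d * M.h1 d - M.capAvg p) (N : ℝ) (d : Fin D) :
    ((M.scaled p N).gen *ᵥ (a + (1 / N) • a')) d =
      (M.scaled p N).netDrain d - M.capAvg p / N := by
  change (M.gen *ᵥ (a + (1 / N) • a')) d =
    M.cap d - M.rateHat p d * (1 - 1 / N) * M.h1 d - M.capAvg p / N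
  rw [Matrix.mulVec_add, Matrix.mulVec_smul, Pi.add_apply, Pi.smul_apply, ha, ha', smul_eq_mul]
  ring

theorem Params.tendsto_scaled_rate (M : Params D K) (p : Fin D → ℝ) (d : Fin D) :
    Tendsto (fun N => (M.scaled p N).rate d) atTop (𝓝 (M.rateHat p d)) := by
  have hinv : Tendsto (fun N : ℝ => 1 / N) atTop (𝓝 0) := tendsto_const_nhds.div_atTop tendsto_id
  have hlim := (hinv.const_sub 1).const_mul (M.rateHat p d)
  rwa [sub_zero, mul_one] at hlim

theorem exists_pos_of_sum_mul_pos {c : Fin D → ℝ} (hp : 0 ≤ p) (h : 0 < ∑ d, p d * c d) :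
    ∃ d, 0 < c d := by
  by_contra! hc
  exact h.not_ge (Finset.sum_nonpos fun d _ => mul_nonpos_of_nonneg_of_nonpos (hp d) (hc d))

variable {μ : ℝ → Measure (S.State × Fin D)}

theorem tendsto_idleProb_of_cap_pos (hM : M.IsAdmissible) (hp : IsInvariant M.gen p)
    (hcap : M.capAvg p ≠ 0) (hload : 0 < M.load p)
    (hμ : ∀ N : ℝ, 1 < N → IsSteadyState (M.scaled p N) S (μ N)) {d : Fin D} (hd : 0 < M.cap d) :
    Tendsto (fun N => idleProb S (μ N) d) atTop (𝓝 0) := by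
  obtain ⟨a, ha⟩ := hM.exists_mulVec_eq_cap_sub hp hcap hload.ne'
  obtain ⟨a', ha'⟩ := hM.exists_mulVec_eq_sub_capAvg hp hcap hload.ne'
  have hbound : Tendsto (fun N : ℝ => M.capAvg p / N / M.cap d) atTop (𝓝 0) := by
    simpa using ((tendsto_const_nhds (x := M.capAvg p)).div_atTop tendsto_id).div_const (M.cap d)
  refine squeeze_zero' (.of_forall fun N => measureReal_nonneg) ?_ hbound
  filter_upwards [eventually_gt_atTop 1] with N hN
  have hsum : ∑ k, M.cap k * idleProb S (μ N) k = M.capAvg p / N :=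
    (hμ N hN).sum_cap_mul_idleProb_eq_of_mulVec (hM.scaled hload hN) hp
      (Params.scaled_mulVec_add_smul ha ha' N)
  rw [le_div_iff₀' hd, ← hsum]
  exact Finset.single_le_sum (f := fun k => M.cap k * idleProb S (μ N) k)
    (fun k _ => mul_nonneg (hM.cap_nonneg k) measureReal_nonneg) (Finset.mem_univ d)

theorem tendsto_idleProb_of_gen_pos (hM : M.IsAdmissible) (hload : 0 < M.load p)
    (hμ : ∀ N : ℝ, 1 < N → IsSteadyState (M.scaled p N) S (μ N)) {i j : Fin D} (hij : i ≠ j)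
    (hgen : 0 < M.gen i j) (hj : Tendsto (fun N => idleProb S (μ N) j) atTop (𝓝 0)) :
    Tendsto (fun N => idleProb S (μ N) i) atTop (𝓝 0) := by
  have hrate : Tendsto (fun N => eventRate (M.scaled p N) j) atTop
      (𝓝 (M.rateHat p j + ∑ l ∈ Finset.univ.erase j, M.gen j l)) :=
    (M.tendsto_scaled_rate p j).add_const _
  have hbound : Tendsto (fun N => eventRate (M.scaled p N) j * idleProb S (μ N) j / M.gen i j)
      atTop (𝓝 0) := by
    simpa using (hrate.mul hj).div_const (M.gen i j)
  refine squeeze_zero' (.of_forall fun N => measureReal_nonneg) ?_ hbound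
  filter_upwards [eventually_gt_atTop 1] with N hN
  rw [le_div_iff₀' hgen]
  exact (hμ N hN).gen_mul_idleProb_le (hM.scaled hload hN) hij

theorem tendsto_idleProb (hM : M.IsAdmissible) (hp : IsInvariant M.gen p) (hcap : 0 < M.capAvg p)
    (hload : 0 < M.load p) (hμ : ∀ N : ℝ, 1 < N → IsSteadyState (M.scaled p N) S (μ N))
    (d : Fin D) : Tendsto (fun N => idleProb S (μ N) d) atTop (𝓝 0) := by
  obtain ⟨m, hm⟩ := exists_pos_of_sum_mul_pos hp.nonneg hcap
  induction hM.irreducible d m using Relation.ReflTransGen.head_induction_on with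
  | refl => exact tendsto_idleProb_of_cap_pos hM hp hcap.ne' hload hμ hm
  | head hij _ ih => exact tendsto_idleProb_of_gen_pos hM hload hμ hij.1 hij.2 ih

theorem integrable_workload_of_scaled (hM : M.IsAdmissible) (hp : IsInvariant M.gen p)
    (hcap : 0 < M.capAvg p) (hload : 0 < M.load p) (hN : 1 < N) {ν : Measure (S.State × Fin D)}
    (hν : IsSteadyState (M.scaled p N) S ν) :
    Integrable (fun q => (S.workload q.1 : ℝ)) ν := by
  obtain ⟨a, ha⟩ := hM.exists_mulVec_eq_cap_sub hp hcap.ne' hload.ne'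
  obtain ⟨a', ha'⟩ := hM.exists_mulVec_eq_sub_capAvg hp hcap.ne' hload.ne'
  exact hν.integrable_workload (hM.scaled hload hN) hp (Params.scaled_mulVec_add_smul ha ha' N)
    (div_pos hcap (zero_lt_one.trans hN))

theorem integral_workload_of_scaled (hM : M.IsAdmissible) (hp : IsInvariant M.gen p)
    (hcap : 0 < M.capAvg p) (hload : 0 < M.load p) (hN : 1 < N) {ν : Measure (S.State × Fin D)}
    (hν : IsSteadyState (M.scaled p N) S ν)
    (ha : ∀ d, (M.gen *ᵥ a) d = M.cap d - M.rateHat p d * M.h1 d)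
    (ha' : ∀ d, (M.gen *ᵥ a') d = M.rateHat p d * M.h1 d - M.capAvg p) :
    1 / N * ∫ q, (S.workload q.1 : ℝ) ∂ν = 1 / M.capAvg p *
      ∑ d, ((M.scaled p N).rate d * M.h2 d / 2 * p d + (a d + 1 / N * a' d) *
        (M.cap d * idleProb S ν d - (M.cap d - (M.scaled p N).rate d * M.h1 d) * p d)) := by
  have hN0 : 0 < N := zero_lt_one.trans hN
  calc 1 / N * ∫ q, (S.workload q.1 : ℝ) ∂ν
      = 1 / M.capAvg p * (M.capAvg p / N * ∫ q, (S.workload q.1 : ℝ) ∂ν) := by field_simp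
    _ = _ := congrArg _ (hν.mul_integral_workload (hM.scaled hload hN) hp
        (Params.scaled_mulVec_add_smul ha ha' N) (div_pos hcap hN0))

theorem tendsto_integral_workload (hM : M.IsAdmissible) (hp : IsInvariant M.gen p)
    (hcap : 0 < M.capAvg p) (hload : 0 < M.load p)
    (hμ : ∀ N : ℝ, 1 < N → IsSteadyState (M.scaled p N) S (μ N))
    (ha : ∀ d, (M.gen *ᵥ a) d = M.cap d - M.rateHat p d * M.h1 d) :
    Tendsto (fun N => 1 / N * ∫ q, (S.workload q.1 : ℝ) ∂(μ N)) atTop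
      (𝓝 (1 / M.capAvg p * ∑ d, p d *
        (M.rateHat p d * M.h2 d / 2 + a d * (M.rateHat p d * M.h1 d - M.cap d)))) := by
  obtain ⟨a', ha'⟩ := hM.exists_mulVec_eq_sub_capAvg hp hcap.ne' hload.ne'
  have hweight : ∀ d, Tendsto (fun N : ℝ => a d + 1 / N * a' d) atTop (𝓝 (a d)) := fun d => by
    have hinv : Tendsto (fun N : ℝ => 1 / N) atTop (𝓝 0) :=
      tendsto_const_nhds.div_atTop tendsto_id
    simpa using (hinv.mul_const (a' d)).const_add (a d)
  have hterm : ∀ d, Tendsto (fun N => (M.scaled p N).rate d * M.h2 d / 2 * p d +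
      (a d + 1 / N * a' d) * (M.cap d * idleProb S (μ N) d -
        (M.cap d - (M.scaled p N).rate d * M.h1 d) * p d)) atTop
      (𝓝 (p d * (M.rateHat p d * M.h2 d / 2 + a d * (M.rateHat p d * M.h1 d - M.cap d)))) :=
    fun d => by
    have hrate := M.tendsto_scaled_rate p d
    have hidle := (tendsto_idleProb hM hp hcap hload hμ d).const_mul (M.cap d)
    have hdrain := ((hrate.mul_const (M.h1 d)).const_sub (M.cap d)).mul_const (p d)
    convert (((hrate.mul_const (M.h2 d)).div_const 2).mul_const (p d)).add
      ((hweight d).mul (hidle.sub hdrain)) using 2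
    ring
  refine ((tendsto_finsetSum _ fun d _ => hterm d).const_mul (1 / M.capAvg p)).congr' ?_
  filter_upwards [eventually_gt_atTop 1] with N hN
  exact (integral_workload_of_scaled hM hp hcap hload hN (hμ N hN) ha ha').symm

end HeavyTraffic

end ModulatedQueue

theorem mainTheorem4 {D : ℕ} {K : Type*} [MeasurableSpace K]
    (M : ModulatedQueue.Params D K) (hM : M.IsAdmissible)
    (p : Fin D → ℝ) (hp : ModulatedQueue.IsInvariant M.gen p)
    (hcap : 0 < M.capAvg p) (hload : 0 < M.load p)
    (S : ModulatedQueue.ServiceDiscipline K)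
    (μ : ℝ → Measure (S.State × Fin D))
    (hμ : ∀ N : ℝ, 1 < N → ModulatedQueue.IsSteadyState (M.scaled p N) S (μ N)) :
    (∃ a : Fin D → ℝ, ∀ d, M.gen.mulVec a d = M.cap d - M.rateHat p d * M.h1 d) ∧
    (∀ N : ℝ, 1 < N → Integrable (fun q => (S.workload q.1 : ℝ)) (μ N)) ∧
    (∀ d, Tendsto (fun N : ℝ => (μ N).real {q | S.workload q.1 = 0 ∧ q.2 = d}) atTop (𝓝 0)) ∧
    (∀ a : Fin D → ℝ, (∀ d, M.gen.mulVec a d = M.cap d - M.rateHat p d * M.h1 d) →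
      Tendsto (fun N : ℝ => 1 / N * ∫ q, (S.workload q.1 : ℝ) ∂(μ N)) atTop
        (𝓝 (1 / M.capAvg p * ∑ d, p d *
          (M.rateHat p d * M.h2 d / 2 + a d * (M.rateHat p d * M.h1 d - M.cap d))))) := by
  exact ⟨hM.exists_mulVec_eq_cap_sub hp hcap.ne' hload.ne',
    fun N hN => ModulatedQueue.integrable_workload_of_scaled hM hp hcap hload hN (hμ N hN),
    ModulatedQueue.tendsto_idleProb hM hp hcap hload hμ,
    fun a ha => ModulatedQueue.tendsto_integral_workload hM hp hcap hload hμ ha⟩
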